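/- Write $\mathbb{N}=\{1,2,3,\dots\}$ and let $\mathbb{P}$ be the set of primes. Let $X$ be a compact metric space. For a continuous map $S\colon X\to X$ and a Borel probability measure $\mu$ on $X$, say that $(X,\mu,S)$ is uniquely ergodic if $\mu$ is $S$-invariant (i.e. $\mu(S^{-1}A)=\mu(A)$ for all Borel sets $A\subset X$) and is the only $S$-invariant Borel probability measure on $X$. (i) Let $T\colon X\to X$ be continuous and let $\mu$ be a Borel probability measure on $X$. Let $a\colon\mathbb{N}\to\mathbb{N}\cup\{0\}$ be completely additive, i.e. $a(nm)=a(n)+a(m)$ for all $n,m\in\mathbb{N}$, and assume that the set $\{a(p):p\in\mathbb{P}\}$ is finite. Put $P_0=\{p\in\mathbb{P}:a(p)\neq 0\}$, and suppose that $\sum_{p\in P_0}1/p=\infty$ and that $(X,\mu,T^{a(p)})$ is uniquely ergodic for every $p\in P_0$ (with the same measure $\mu$). Then $$\lim_{N\to\infty}\frac1N\sum_{n=1}^N f\big(T^{a(n)}x\big)=\int f\,d\mu$$ for every continuous $f\colon X\to\mathbb{C}$ and every $x\in X$. (ii) For a set of primes $\mathcal{Q}\subset\mathbb{P}$ let $\Omega_{\mathcal{Q}}(n)$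 be the number of prime factors of $n$ that belong to $\mathcal{Q}$, counted with multiplicity, and put $\boldsymbol{\lambda}_{\mathcal{Q}}(n)=(-1)^{\Omega_{\mathcal{Q}}(n)}$. If $\sum_{p\in\mathcal{Q}}1/p=\infty$, then $$\lim_{N\to\infty}\frac1N\sum_{n=1}^N\boldsymbol{\lambda}_{\mathcal{Q}}(n)=0.$$ (iii) (Wirsing) The conclusion of (ii) holds in particular if $\mathcal{Q}\subset\mathbb{P}$ has positive relative density in the primes, i.e. if $|\mathcal{Q}\cap[1,n]|\sim\tau n/\log n$ as $n\to\infty$ for some $\tau>0$. -/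

import Mathlib

open Filter Topology MeasureTheory

/-- `(X, μ, S)` is uniquely ergodic: `S` is continuous, and `μ` is an `S`-invariant Borel
probability measure and the only such measure. -/
structure UniquelyErgodic {X : Type*} [TopologicalSpace X] [MeasurableSpace X]
    (μ : Measure X) (S : X → X) : Prop where
  continuous : Continuous S
  isProbabilityMeasure : IsProbabilityMeasure μ
  invariant : MeasurePreserving S μ μ
  unique : ∀ ν : Measure X, IsProbabilityMeasure ν → MeasurePreserving S ν ν → ν = μ

/-- Complete additivity of a function on the positive integers (the value at `0` is ignored). -/
def CompletelyAdditive (a : ℕ → ℕ) : Prop :=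
  ∀ m n : ℕ, m ≠ 0 → n ≠ 0 → a (m * n) = a m + a n

/-- `∑ p ∈ P, 1 / p = ∞`. -/
def ReciprocalSumDiverges (P : Set ℕ) : Prop :=
  ¬ Summable (P.indicator fun p : ℕ => 1 / (p : ℝ))

/-- The number of prime factors of `n` that belong to `Q`, counted with multiplicity. -/
noncomputable def bigOmegaIn (Q : Set ℕ) (n : ℕ) : ℕ :=
  open scoped Classical in ∑ p ∈ n.primeFactors with p ∈ Q, n.factorization p

/-- The variant `λ_Q(n) = (-1) ^ Ω_Q(n)` of the Liouville function. -/
noncomputable def liouvilleIn (Q : Set ℕ) (n : ℕ) : ℝ :=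
  (-1) ^ bigOmegaIn Q n

/-- The set `Q` has relative density `τ` in the primes: `|Q ∩ [1, n]| ∼ τ n / log n`. -/
def HasRelativePrimeDensity (Q : Set ℕ) (τ : ℝ) : Prop :=
  Asymptotics.IsEquivalent atTop (fun n : ℕ => ((Q ∩ Set.Icc 1 n).ncard : ℝ))
    (fun n : ℕ => τ * n / Real.log n)

/-! Write M_w(x) for the mean of F(a(m) + w) over m ≤ x. By Turán–Kubilius, most integers have about
the expected weighted number of divisors from a finite set of primes of large reciprocal sum L.
Hence M_0(x) is within √(2/L) of a weighted average of the means of F(a(pm)) over m ≤ x/p, and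
additivity turns these into M_{a(p)}(x/p).

If Σ 1/p diverges over the primes with a(p) = v, then M_0(x) is close to an average of M_v(x/p). To
conclude M_0 − M_v → 0 one needs M_v(x/p) − M_v(x) → 0 (`tendsto_meanUpTo_sub_scale`). For this, cut
the primes into windows of logarithmic length ε and colour each window by the value of a that
dominates its reciprocal sum. Pigeonhole finds two families of windows of equal colour and divergent
weight, one a translate of the other. Averaging over either family with the same weights gives the
same quantity at two scales, so M_0(x) ≈ M_0(x e^{rh}) with r bounded in terms of the number of
values only.

Shift invariance makes every weak-* cluster point of the empirical measures along T^{a(n)}x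
invariant under T^v, so unique ergodicity gives (i). With F(k) = (−1)^k and v = 1, M_v = −M_0, which
gives (ii). For (iii), relative density forces divergence by a dyadic count.

The arithmetic input is `WindowLowerBound`: window j carries reciprocal mass at least c/j. It is
proved by a one-sided Fejér-kernel argument of Wiener–Ikehara type, from the continuity of −ζ'/ζ − ζ
up to Re s = 1. -/

/-! ### Means, the Turán–Kubilius inequality, and averaging over multiples of primes. -/

/-- The mean `(1 / x) ∑_{1 ≤ m ≤ x} G m`. -/
noncomputable def meanUpTo (G : ℕ → ℂ) (x : ℝ) : ℂ :=
  (∑ m ∈ Finset.Icc 1 ⌊x⌋₊, G m) / (x : ℂ)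

theorem norm_sum_Icc_floor_le {G : ℕ → ℂ} (hG : ∀ n, ‖G n‖ ≤ 1) {x : ℝ} (hx : 0 ≤ x) :
    ‖∑ m ∈ Finset.Icc 1 ⌊x⌋₊, G m‖ ≤ x := by
  calc ‖∑ m ∈ Finset.Icc 1 ⌊x⌋₊, G m‖ ≤ ∑ m ∈ Finset.Icc 1 ⌊x⌋₊, ‖G m‖ := norm_sum_le _ _
    _ ≤ ∑ m ∈ Finset.Icc 1 ⌊x⌋₊, (1 : ℝ) := Finset.sum_le_sum fun m _ => hG m
    _ = ⌊x⌋₊ := by simp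
    _ ≤ x := Nat.floor_le hx

theorem norm_meanUpTo_sub_le {G : ℕ → ℂ} (hG : ∀ n, ‖G n‖ ≤ 1) {x y : ℝ} (hx : 0 < x)
    (hxy : x ≤ y) : ‖meanUpTo G x - meanUpTo G y‖ ≤ 2 * (1 - x / y) + 1 / y := by
  have hy : 0 < y := hx.trans_le hxy
  set S := ∑ m ∈ Finset.Icc 1 ⌊x⌋₊, G m
  have hfl : ⌊x⌋₊ ≤ ⌊y⌋₊ := Nat.floor_mono hxy
  have hsplit : ∑ m ∈ Finset.Icc 1 ⌊y⌋₊, G m = S + ∑ m ∈ Finset.Ioc ⌊x⌋₊ ⌊y⌋₊, G m := by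
    have h : ∀ k : ℕ, Finset.Icc 1 k = Finset.Ioc 0 k := fun k => by ext; simp; omega
    simp only [S, h]
    exact (Finset.sum_Ioc_consecutive G (Nat.zero_le _) hfl).symm
  have hS : ‖S‖ ≤ x := norm_sum_Icc_floor_le hG hx.le
  have hT : ‖∑ m ∈ Finset.Ioc ⌊x⌋₊ ⌊y⌋₊, G m‖ ≤ y - x + 1 := by
    calc _ ≤ ∑ m ∈ Finset.Ioc ⌊x⌋₊ ⌊y⌋₊, ‖G m‖ := norm_sum_le _ _
      _ ≤ ∑ m ∈ Finset.Ioc ⌊x⌋₊ ⌊y⌋₊, (1 : ℝ) := Finset.sum_le_sum fun m _ => hG m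
      _ = (⌊y⌋₊ : ℝ) - ⌊x⌋₊ := by simp [Nat.cast_sub hfl]
      _ ≤ _ := by linarith [Nat.floor_le hy.le, Nat.lt_floor_add_one x]
  have hx' : (x : ℂ) ≠ 0 := by exact_mod_cast hx.ne'
  have hy' : (y : ℂ) ≠ 0 := by exact_mod_cast hy.ne'
  have e : meanUpTo G x - meanUpTo G y
      = S * ((1 / x - 1 / y : ℝ) : ℂ) - (∑ m ∈ Finset.Ioc ⌊x⌋₊ ⌊y⌋₊, G m) / y := by
    rw [meanUpTo, meanUpTo, hsplit]; push_cast; ring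
  have h1 : 0 ≤ 1 / x - 1 / y := sub_nonneg.2 (one_div_le_one_div_of_le hx hxy)
  calc ‖meanUpTo G x - meanUpTo G y‖
      ≤ ‖S‖ * (1 / x - 1 / y) + ‖∑ m ∈ Finset.Ioc ⌊x⌋₊ ⌊y⌋₊, G m‖ / y := by
        rw [e]; refine (norm_sub_le _ _).trans (le_of_eq ?_)
        rw [norm_mul, norm_div, Complex.norm_real, Complex.norm_real, Real.norm_of_nonneg h1,
          Real.norm_of_nonneg hy.le]
    _ ≤ x * (1 / x - 1 / y) + (y - x + 1) / y := by gcongr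
    _ = _ := by field_simp; ring

theorem card_filter_dvd_Icc (N d : ℕ) :
    ((Finset.Icc 1 N).filter (d ∣ ·)).card = N / d := by
  have : Finset.Icc 1 N = Finset.Ioc 0 N := by ext; simp; omega
  rw [this, Nat.Ioc_filter_dvd_card_eq_div]

/-- The Turán–Kubilius inequality for a finite set of weighted primes. -/
theorem turan_kubilius {P : Finset ℕ} (hP : ∀ p ∈ P, p.Prime) {c : ℕ → ℝ} (hc0 : ∀ p, 0 ≤ c p)
    (hc1 : ∀ p, c p ≤ 1) {x : ℝ} (hx : 0 ≤ x) :
    ∑ n ∈ Finset.Icc 1 ⌊x⌋₊,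
        ((∑ p ∈ P, if p ∣ n then c p else 0) - ∑ p ∈ P, c p / p) ^ 2
      ≤ (x + 2 * P.card) * ∑ p ∈ P, c p / p := by
  set L := ∑ p ∈ P, c p / p
  have hL : 0 ≤ L := Finset.sum_nonneg fun p _ => div_nonneg (hc0 p) p.cast_nonneg
  set N := ⌊x⌋₊
  have hN : (N : ℝ) ≤ x := Nat.floor_le hx
  have hN' : x < N + 1 := Nat.lt_floor_add_one x
  -- A lower bound for the first moment suffices, since it enters the expanded square with the
  -- coefficient −2L ≤ 0.
  have h1 : x * L - P.card ≤ ∑ n ∈ Finset.Icc 1 N, ∑ p ∈ P, if p ∣ n then c p else 0 := by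
    rw [Finset.sum_comm]
    have : ∀ p ∈ P, x * (c p / p) - 1 ≤ ∑ n ∈ Finset.Icc 1 N, if p ∣ n then c p else 0 := by
      intro p hp
      rw [← Finset.sum_filter, Finset.sum_const, card_filter_dvd_Icc, nsmul_eq_mul]
      have hp0 : (0 : ℝ) < p := by exact_mod_cast (hP p hp).pos
      have : x / p < (N / p : ℕ) + 1 := by
        rw [div_lt_iff₀ hp0]
        have h2 : N < p * (N / p + 1) := Nat.lt_mul_div_succ N (hP p hp).pos
        have h3 : (N : ℝ) + 1 ≤ p * ((N / p : ℕ) + 1) := by exact_mod_cast h2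
        nlinarith
      have h4 : x * (c p / p) = x / p * c p := by ring
      have := mul_le_mul_of_nonneg_right this.le (hc0 p)
      nlinarith [hc1 p]
    calc x * L - P.card = ∑ p ∈ P, (x * (c p / p) - 1) := by
          rw [Finset.sum_sub_distrib, ← Finset.mul_sum]; simp [L]
      _ ≤ _ := Finset.sum_le_sum this
  have h2 : ∑ n ∈ Finset.Icc 1 N, (∑ p ∈ P, if p ∣ n then c p else 0) ^ 2
      ≤ x * (L ^ 2 + L) := by
    -- Off the diagonal the lcm is pq and the weights factor; the diagonal is controlled by c p ^ 2
    -- ≤ c p and produces the linear term x L.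
    have key : ∀ p ∈ P, ∀ q ∈ P,
        ∑ n ∈ Finset.Icc 1 N, (if p ∣ n then c p else 0) * (if q ∣ n then c q else 0)
          ≤ x * (c p / p * (c q / q)) + if p = q then x * (c p / p) else 0 := by
      intro p hp q hq
      have hp0 : (0 : ℝ) < p := by exact_mod_cast (hP p hp).pos
      have hq0 : (0 : ℝ) < q := by exact_mod_cast (hP q hq).pos
      have e : ∀ n, (if p ∣ n then c p else 0) * (if q ∣ n then c q else 0)
          = if p.lcm q ∣ n then c p * c q else 0 := by
        intro n
        simp only [Nat.lcm_dvd_iff]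
        by_cases h : p ∣ n <;> by_cases h' : q ∣ n <;> simp [h, h']
      simp only [e]
      rw [← Finset.sum_filter, Finset.sum_const, card_filter_dvd_Icc, nsmul_eq_mul]
      have hcc : 0 ≤ c p * c q := mul_nonneg (hc0 p) (hc0 q)
      have hd : ((N / p.lcm q : ℕ) : ℝ) ≤ x / (p.lcm q : ℕ) :=
        Nat.cast_div_le.trans (div_le_div_of_nonneg_right hN (Nat.cast_nonneg _))
      refine (mul_le_mul_of_nonneg_right hd hcc).trans ?_
      by_cases hpq : p = q
      · subst hpq
        simp only [Nat.lcm_self, if_true]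
        have : 0 ≤ x * (c p / p * (c p / p)) := by
          have := hc0 p; positivity
        have h5 : x / p * (c p * c p) ≤ x / p * c p :=
          mul_le_mul_of_nonneg_left (mul_le_of_le_one_left (hc0 p) (hc1 p)) (by positivity)
        have : x / p * c p = x * (c p / p) := by ring
        linarith
      · have hco : p.lcm q = p * q := ((Nat.coprime_primes (hP p hp) (hP q hq)).2 hpq).lcm_eq_mul
        rw [if_neg hpq, hco]; push_cast
        apply le_of_eq; field_simp; ring
    calc ∑ n ∈ Finset.Icc 1 N, (∑ p ∈ P, if p ∣ n then c p else 0) ^ 2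
        = ∑ p ∈ P, ∑ q ∈ P, ∑ n ∈ Finset.Icc 1 N,
            (if p ∣ n then c p else 0) * (if q ∣ n then c q else 0) := by
          simp only [sq, Finset.sum_mul_sum]
          rw [Finset.sum_comm]
          exact Finset.sum_congr rfl fun p _ => Finset.sum_comm
      _ ≤ ∑ p ∈ P, ∑ q ∈ P, (x * (c p / p * (c q / q)) + if p = q then x * (c p / p) else 0) :=
          Finset.sum_le_sum fun p hp => Finset.sum_le_sum fun q hq => key p hp q hq
      _ = x * (L ^ 2 + L) := by
          simp only [Finset.sum_add_distrib, Finset.sum_ite_eq, ← Finset.mul_sum, mul_add, sq, L]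
          rw [Finset.sum_mul]
          congr 1
          rw [Finset.mul_sum]
          exact Finset.sum_congr rfl fun p hp => by simp [hp]
  calc _ = ∑ n ∈ Finset.Icc 1 N, (∑ p ∈ P, if p ∣ n then c p else 0) ^ 2
        - 2 * L * ∑ n ∈ Finset.Icc 1 N, (∑ p ∈ P, if p ∣ n then c p else 0) + N * L ^ 2 := by
        simp only [sub_sq, Finset.sum_add_distrib, Finset.sum_sub_distrib, Finset.sum_const,
          Nat.card_Icc, nsmul_eq_mul, Finset.mul_sum]
        simp only [Nat.add_sub_cancel]
        congr 2
        refine Finset.sum_congr rfl fun n _ => ?_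
        rw [Finset.sum_mul]
        exact Finset.sum_congr rfl fun p _ => by ring
    _ ≤ x * (L ^ 2 + L) - 2 * L * (x * L - P.card) + x * L ^ 2 := by gcongr
    _ = _ := by ring

theorem sum_Icc_ite_dvd (G : ℕ → ℂ) {p : ℕ} (hp : 0 < p) (x : ℝ) :
    ∑ n ∈ Finset.Icc 1 ⌊x⌋₊, (if p ∣ n then G n else 0)
      = ∑ m ∈ Finset.Icc 1 ⌊x / p⌋₊, G (p * m) := by
  rw [Nat.floor_div_natCast, ← Finset.sum_filter]
  symm
  refine Finset.sum_nbij (p * ·) ?_ ?_ ?_ fun _ _ => rfl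
  · intro m hm
    simp only [Finset.mem_Icc, Finset.mem_filter] at hm ⊢
    refine ⟨⟨Nat.mul_pos hp hm.1, ?_⟩, dvd_mul_right _ _⟩
    rw [mul_comm]; exact (Nat.le_div_iff_mul_le hp).1 hm.2
  · intro m _ m' _ h
    exact Nat.eq_of_mul_eq_mul_left hp h
  · intro n hn
    simp only [Finset.coe_filter, Finset.mem_Icc, Set.mem_ofPred_eq] at hn
    obtain ⟨m, rfl⟩ := hn.2
    refine ⟨m, ?_, rfl⟩
    simp only [Finset.coe_Icc, Set.mem_Icc]
    refine ⟨Nat.pos_of_mul_pos_left hn.1.1, ?_⟩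
    rw [Nat.le_div_iff_mul_le hp, mul_comm]; exact hn.1.2

/-- A mean over all integers is a weighted mean over multiples of primes. -/
theorem norm_meanUpTo_sub_prime_average_le {P : Finset ℕ} (hP : ∀ p ∈ P, p.Prime) {c : ℕ → ℝ}
    (hc0 : ∀ p, 0 ≤ c p) (hc1 : ∀ p, c p ≤ 1) {L : ℝ} (hL : ∑ p ∈ P, c p / p = L) (hLpos : 0 < L)
    {G : ℕ → ℂ} (hG : ∀ n, ‖G n‖ ≤ 1) {x : ℝ} (hx : 0 < x) (hxP : 2 * P.card ≤ x) :
    ‖meanUpTo G x - (∑ p ∈ P, ((c p / p : ℝ) : ℂ) * meanUpTo (fun m => G (p * m)) (x / p)) / L‖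
      ≤ √(2 / L) := by
  set X : ℕ → ℝ := fun n => (∑ p ∈ P, if p ∣ n then c p else 0) - L
  have hTK : ∑ n ∈ Finset.Icc 1 ⌊x⌋₊, X n ^ 2 ≤ (x + 2 * P.card) * L := by
    have := turan_kubilius hP hc0 hc1 hx.le
    rwa [hL] at this
  have hx' : (x : ℂ) ≠ 0 := by exact_mod_cast hx.ne'
  have hL' : (L : ℂ) ≠ 0 := by exact_mod_cast hLpos.ne'
  -- Interchanging sums writes the error as the correlation of G with the centred divisor count X,
  -- which Cauchy–Schwarz and Turán–Kubilius bound.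
  have e : meanUpTo G x
      - (∑ p ∈ P, ((c p / p : ℝ) : ℂ) * meanUpTo (fun m => G (p * m)) (x / p)) / L
      = - (∑ n ∈ Finset.Icc 1 ⌊x⌋₊, (X n : ℂ) * G n) / (x * L) := by
    have h1 : ∀ p ∈ P, ((c p / p : ℝ) : ℂ) * meanUpTo (fun m => G (p * m)) (x / p)
        = (∑ n ∈ Finset.Icc 1 ⌊x⌋₊, if p ∣ n then (c p : ℂ) * G n else 0) / x := by
      intro p hp
      have hp0 : (p : ℂ) ≠ 0 := by exact_mod_cast (hP p hp).ne_zero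
      rw [sum_Icc_ite_dvd (fun n => (c p : ℂ) * G n) (hP p hp).pos, meanUpTo, ← Finset.mul_sum]
      push_cast
      field_simp
    rw [Finset.sum_congr rfl h1, ← Finset.sum_div, Finset.sum_comm, meanUpTo]
    have h2 : ∑ n ∈ Finset.Icc 1 ⌊x⌋₊, (X n : ℂ) * G n
        = ∑ n ∈ Finset.Icc 1 ⌊x⌋₊, (∑ p ∈ P, if p ∣ n then (c p : ℂ) * G n else 0)
          - L * ∑ n ∈ Finset.Icc 1 ⌊x⌋₊, G n := by
      rw [Finset.mul_sum, ← Finset.sum_sub_distrib]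
      refine Finset.sum_congr rfl fun n _ => ?_
      simp only [X]
      push_cast
      rw [sub_mul, Finset.sum_mul]
      congr 1
      exact Finset.sum_congr rfl fun p _ => by split_ifs <;> simp
    rw [h2]
    field_simp
    ring
  have hCS : ‖∑ n ∈ Finset.Icc 1 ⌊x⌋₊, (X n : ℂ) * G n‖ ≤ √(2 * x ^ 2 * L) := by
    apply Real.le_sqrt_of_sq_le
    calc ‖∑ n ∈ Finset.Icc 1 ⌊x⌋₊, (X n : ℂ) * G n‖ ^ 2
        ≤ (∑ n ∈ Finset.Icc 1 ⌊x⌋₊, |X n|) ^ 2 := by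
          gcongr
          refine (norm_sum_le _ _).trans (Finset.sum_le_sum fun n _ => ?_)
          rw [norm_mul, Complex.norm_real, Real.norm_eq_abs]
          exact mul_le_of_le_one_right (abs_nonneg _) (hG n)
      _ ≤ (Finset.Icc 1 ⌊x⌋₊).card * ∑ n ∈ Finset.Icc 1 ⌊x⌋₊, |X n| ^ 2 :=
          sq_sum_le_card_mul_sum_sq
      _ ≤ x * ((x + 2 * P.card) * L) := by
          simp only [sq_abs]
          gcongr
          simpa using Nat.floor_le hx.le
      _ ≤ x * ((x + x) * L) := by gcongr
      _ = 2 * x ^ 2 * L := by ring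
  rw [e, norm_div, norm_neg, norm_mul, Complex.norm_real, Complex.norm_real,
    Real.norm_of_nonneg hx.le, Real.norm_of_nonneg hLpos.le, div_le_iff₀ (by positivity)]
  refine hCS.trans (le_of_eq ?_)
  rw [show 2 * x ^ 2 * L = (2 / L) * (x * L) ^ 2 by field_simp, Real.sqrt_mul (by positivity),
    Real.sqrt_sq (by positivity)]

theorem meanUpTo_congr {G G' : ℕ → ℂ} (h : ∀ n, n ≠ 0 → G n = G' n) (x : ℝ) :
    meanUpTo G x = meanUpTo G' x := by
  unfold meanUpTo
  congr 1
  exact Finset.sum_congr rfl fun n hn => h n (by have := (Finset.mem_Icc.1 hn).1; omega)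

/-! ### Logarithmic windows of primes and invariance of means under change of scale. -/

/-- The primes `p` with `ε j ≤ log p < ε (j + 1)`. -/
noncomputable def primeWindow (ε : ℝ) (j : ℕ) : Finset ℕ :=
  (Finset.range (⌊Real.exp (ε * (j + 1))⌋₊ + 1)).filter
    fun p => p.Prime ∧ ⌊Real.log p / ε⌋₊ = j

theorem mem_primeWindow {ε : ℝ} (hε : 0 < ε) {j p : ℕ} :
    p ∈ primeWindow ε j ↔ p.Prime ∧ ⌊Real.log p / ε⌋₊ = j := by
  simp only [primeWindow, Finset.mem_filter, Finset.mem_range, and_iff_right_iff_imp]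
  rintro ⟨hp, rfl⟩
  have hp0 : (0 : ℝ) < p := by exact_mod_cast hp.pos
  refine Nat.lt_succ_of_le (Nat.le_floor ?_)
  rw [← Real.log_le_iff_le_exp hp0]
  have := (Nat.lt_floor_add_one (Real.log p / ε)).le
  rw [div_le_iff₀ hε] at this
  linarith

theorem bounds_of_mem_primeWindow {ε : ℝ} (hε : 0 < ε) {j p : ℕ} (hp : p ∈ primeWindow ε j) :
    Real.exp (ε * j) ≤ p ∧ p ≤ Real.exp (ε * j) * Real.exp ε := by
  obtain ⟨hpp, rfl⟩ := (mem_primeWindow hε).1 hp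
  have hp0 : (0 : ℝ) < p := by exact_mod_cast hpp.pos
  have h0 : 0 ≤ Real.log p / ε := div_nonneg (Real.log_natCast_nonneg p) hε.le
  rw [← Real.exp_add, ← Real.le_log_iff_exp_le hp0, ← Real.log_le_iff_le_exp hp0]
  have h1 := (Nat.lt_floor_add_one (Real.log p / ε)).le
  have h2 := Nat.floor_le h0
  rw [div_le_iff₀ hε] at h1
  rw [le_div_iff₀ hε] at h2
  constructor <;> linarith

/-- Within a window x/p differs from x e^{−εi} by a factor at most e^ε, so all its primes may share
one scale at cost 3ε. The weights μ are prescribed and not read off from the primes, so that two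
families of windows can later carry identical weights. -/
theorem norm_meanUpTo_sub_window_average_le {a : ℕ → ℕ} (ha : CompletelyAdditive a) {F : ℕ → ℂ}
    (hF : ∀ k, ‖F k‖ ≤ 1) {ε : ℝ} (hε : 0 < ε) (w : ℕ) {I : Finset ℕ} {μ : ℕ → ℝ}
    (hμ0 : ∀ i, 0 ≤ μ i)
    (hμ : ∀ i ∈ I, μ i ≤ ∑ p ∈ (primeWindow ε i).filter (a · = w), 1 / (p : ℝ))
    {L : ℝ} (hL : ∑ i ∈ I, μ i = L) (hLpos : 0 < L) :
    ∀ᶠ x : ℝ in atTop, ‖meanUpTo (fun m => F (a m)) x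
      - (∑ i ∈ I, (μ i : ℂ) * meanUpTo (fun m => F (a m + w)) (x * Real.exp (-(ε * i)))) / L‖
      ≤ √(2 / L) + 3 * ε := by
  set A : ℕ → Finset ℕ := fun i => (primeWindow ε i).filter (a · = w)
  set s : ℕ → ℝ := fun i => ∑ p ∈ A i, 1 / (p : ℝ)
  -- Thinning factor: weighting each prime of window i by κ i brings its reciprocal mass down to
  -- exactly μ i.
  set κ : ℕ → ℝ := fun i => if i ∈ I then μ i / s i else 0
  set P := I.biUnion A
  have hs0 : ∀ i, 0 ≤ s i := fun i => Finset.sum_nonneg fun p _ => by positivity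
  have hκ0 : ∀ i, 0 ≤ κ i := fun i => by
    simp only [κ]; split_ifs; exacts [div_nonneg (hμ0 i) (hs0 i), le_rfl]
  have hκ1 : ∀ i, κ i ≤ 1 := fun i => by
    simp only [κ]; split_ifs with h
    exacts [div_le_one_of_le₀ (hμ i h) (hs0 i), zero_le_one]
  have hκs : ∀ i ∈ I, κ i * s i = μ i := fun i hi => by
    simp only [κ, if_pos hi]
    -- A window of zero mass forces μ i = 0, which agrees with the value of division by zero.
    rcases eq_or_ne (s i) 0 with h | h
    · have := hμ i hi
      rw [h, mul_zero]; exact (le_antisymm (this.trans h.le) (hμ0 i)).symm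
    · exact div_mul_cancel₀ _ h
  have hA : ∀ {i p}, p ∈ A i → p.Prime ∧ ⌊Real.log p / ε⌋₊ = i ∧ a p = w := fun {i p} hp => by
    have := Finset.mem_filter.1 hp
    have h2 := (mem_primeWindow hε).1 this.1
    exact ⟨h2.1, h2.2, this.2⟩
  have hP : ∀ p ∈ P, p.Prime := fun p hp => by
    obtain ⟨i, _, hi⟩ := Finset.mem_biUnion.1 hp
    exact (hA hi).1
  have hdisj : Set.PairwiseDisjoint (I : Set ℕ) A := by
    intro i _ j _ hij
    refine Finset.disjoint_left.2 fun p hpi hpj => hij ?_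
    rw [← (hA hpi).2.1, ← (hA hpj).2.1]
  set c : ℕ → ℝ := fun p => κ ⌊Real.log p / ε⌋₊
  have hcL : ∑ p ∈ P, c p / p = L := by
    rw [Finset.sum_biUnion hdisj, ← hL]
    refine Finset.sum_congr rfl fun i hi => ?_
    rw [← hκs i hi, Finset.mul_sum]
    refine Finset.sum_congr rfl fun p hp => ?_
    simp only [c, (hA hp).2.1]; ring
  have hF' : ∀ n, ‖F (a n + w)‖ ≤ 1 := fun n => hF _
  have hlarge : ∀ᶠ x : ℝ in atTop, ∀ i ∈ I, 1 / ε ≤ x * Real.exp (-(ε * i)) := by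
    rw [Filter.eventually_all_finset]
    intro i _
    exact (tendsto_id.atTop_mul_const (Real.exp_pos _)).eventually_ge_atTop _
  filter_upwards [hlarge, eventually_gt_atTop 0, eventually_ge_atTop (2 * (P.card : ℝ))]
    with x hx1 hx0 hxP
  have h1 := norm_meanUpTo_sub_prime_average_le hP (fun p => hκ0 _) (fun p => hκ1 _) hcL hLpos
    (G := fun m => F (a m)) (fun n => hF _) hx0 hxP
  have h2 : ∑ p ∈ P, ((c p / p : ℝ) : ℂ) * meanUpTo (fun m => F (a (p * m))) (x / p)
      = ∑ i ∈ I, ∑ p ∈ A i, ((κ i / p : ℝ) : ℂ) * meanUpTo (fun m => F (a m + w)) (x / p) := by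
    rw [Finset.sum_biUnion hdisj]
    refine Finset.sum_congr rfl fun i hi => Finset.sum_congr rfl fun p hp => ?_
    obtain ⟨hp1, hp2, hp3⟩ := hA hp
    simp only [c, hp2]
    congr 1
    refine meanUpTo_congr (fun n hn => ?_) _
    rw [ha p n hp1.ne_zero hn, hp3, add_comm]
  have h3 : ∑ i ∈ I, (μ i : ℂ) * meanUpTo (fun m => F (a m + w)) (x * Real.exp (-(ε * i)))
      = ∑ i ∈ I, ∑ p ∈ A i, ((κ i / p : ℝ) : ℂ)
        * meanUpTo (fun m => F (a m + w)) (x * Real.exp (-(ε * i))) := by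
    refine Finset.sum_congr rfl fun i hi => ?_
    rw [← hκs i hi, ← Finset.sum_mul, ← Complex.ofReal_sum]
    congr 2
    rw [Finset.mul_sum]
    exact Finset.sum_congr rfl fun p _ => by ring
  have h4 : ∀ i ∈ I, ∀ p ∈ A i, ‖meanUpTo (fun m => F (a m + w)) (x / p)
      - meanUpTo (fun m => F (a m + w)) (x * Real.exp (-(ε * i)))‖ ≤ 3 * ε := by
    intro i hi p hp
    obtain ⟨hb1, hb2⟩ := bounds_of_mem_primeWindow hε (Finset.mem_filter.1 hp).1
    have hp0 : (0 : ℝ) < p := by exact_mod_cast (hA hp).1.pos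
    have hy : 0 < x * Real.exp (-(ε * i)) := by positivity
    have hle : x / p ≤ x * Real.exp (-(ε * i)) := by
      rw [Real.exp_neg, ← div_eq_mul_inv]; gcongr
    refine (norm_meanUpTo_sub_le hF' (by positivity) hle).trans ?_
    have e1 : x / p / (x * Real.exp (-(ε * i))) = Real.exp (ε * i) / p := by
      rw [Real.exp_neg]; field_simp
    have e2 : 1 - ε ≤ Real.exp (ε * i) / p := by
      rw [le_div_iff₀ hp0]
      rcases le_or_gt (1 - ε) 0 with h | h
      · exact (mul_nonpos_of_nonpos_of_nonneg h hp0.le).trans (Real.exp_pos _).le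
      calc (1 - ε) * p ≤ Real.exp (-ε) * (Real.exp (ε * i) * Real.exp ε) := by
            gcongr; linarith [Real.add_one_le_exp (-ε)]
        _ = Real.exp (ε * i) := by rw [Real.exp_neg]; field_simp
    have e3 : 1 / (x * Real.exp (-(ε * i))) ≤ ε := by
      rw [one_div_le hy hε]; exact hx1 i hi
    rw [e1]; linarith
  have h5 : ‖∑ i ∈ I, ∑ p ∈ A i, ((κ i / p : ℝ) : ℂ) * meanUpTo (fun m => F (a m + w)) (x / p)
      - ∑ i ∈ I, ∑ p ∈ A i, ((κ i / p : ℝ) : ℂ)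
        * meanUpTo (fun m => F (a m + w)) (x * Real.exp (-(ε * i)))‖ ≤ L * (3 * ε) := by
    rw [← hL, Finset.sum_mul, ← Finset.sum_sub_distrib]
    refine (norm_sum_le _ _).trans (Finset.sum_le_sum fun i hi => ?_)
    rw [← hκs i hi, Finset.mul_sum, Finset.sum_mul, ← Finset.sum_sub_distrib]
    refine (norm_sum_le _ _).trans (Finset.sum_le_sum fun p hp => ?_)
    have hkp : 0 ≤ κ i / p := div_nonneg (hκ0 i) p.cast_nonneg
    rw [← mul_sub, norm_mul, Complex.norm_real, Real.norm_of_nonneg hkp, mul_one_div]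
    exact mul_le_mul_of_nonneg_left (h4 i hi p hp) hkp
  rw [h2] at h1
  rw [h3]
  refine (norm_sub_le_norm_sub_add_norm_sub _ _ _).trans (add_le_add h1 ?_)
  rw [← sub_div, norm_div, Complex.norm_real, Real.norm_of_nonneg hLpos.le, div_le_iff₀ hLpos]
  linarith [h5]

theorem exists_finset_sum_ge_of_not_summable {f : ℕ → ℝ} (hf : ∀ n, 0 ≤ f n) {J : Set ℕ}
    (h : ¬ Summable (J.indicator f)) (B : ℝ) :
    ∃ s : Finset ℕ, (∀ j ∈ s, j ∈ J) ∧ B ≤ ∑ j ∈ s, f j := by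
  classical
  by_contra! hcon
  refine h (summable_of_sum_le (c := B) (fun n => Set.indicator_nonneg (fun _ _ => hf _) _)
    fun u => ?_)
  rw [Finset.sum_indicator_eq_sum_filter u (fun _ => f) (fun _ => J) (fun n => n)]
  exact (hcon _ fun j hj => (Finset.mem_filter.1 hj).2).le

/-- A finite colouring has, along some arithmetic pattern `j + r₁ D`, `j + r₂ D`, a fixed colour
for a set of `j` on which the harmonic-type series still diverges. -/
theorem exists_repeated_colour {W : Finset ℕ} {col : ℕ → ℕ} {j₀ : ℕ}
    (hcol : ∀ i, j₀ ≤ i → col i ∈ W) (D : ℕ) {f : ℕ → ℝ} (hf : ∀ n, 0 ≤ f n)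
    (hfs : ¬ Summable f) :
    ∃ r₁ r₂ w, r₁ < r₂ ∧ r₂ ≤ W.card ∧
      ¬ Summable ({j | j₀ ≤ j ∧ col (j + r₁ * D) = w ∧ col (j + r₂ * D) = w}.indicator f) := by
  classical
  by_contra! hcon
  set K := W.card
  set T : Finset ((ℕ × ℕ) × ℕ) := (((Finset.range (K + 1)) ×ˢ (Finset.range (K + 1))) ×ˢ W).filter
    fun τ => τ.1.1 < τ.1.2
  set J : (ℕ × ℕ) × ℕ → Set ℕ := fun τ =>
    {j | j₀ ≤ j ∧ col (j + τ.1.1 * D) = τ.2 ∧ col (j + τ.1.2 * D) = τ.2}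
  -- If every pattern gave a convergent series, so would their finite sum; yet from j₀ on that sum
  -- dominates f, by pigeonhole on the K + 1 indices n, n + D, …, n + K D.
  have hs : Summable (∑ τ ∈ T, (J τ).indicator f) := by
    rw [show (∑ τ ∈ T, (J τ).indicator f) = fun n => ∑ τ ∈ T, (J τ).indicator f n by
      ext n; simp]
    refine summable_sum fun τ hτ => ?_
    simp only [T, Finset.mem_filter, Finset.mem_product, Finset.mem_range] at hτ
    exact hcon τ.1.1 τ.1.2 τ.2 hτ.2 (by omega)
  have hnn : ∀ τ n, 0 ≤ (J τ).indicator f n := fun τ n =>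
    Set.indicator_nonneg (fun _ _ => hf _) _
  refine hfs ((summable_nat_add_iff j₀).1 ?_)
  refine Summable.of_nonneg_of_le (fun n => hf _) (fun n => ?_) ((summable_nat_add_iff j₀).2 hs)
  obtain ⟨r, hr, r', hr', hne, heq⟩ := Finset.exists_ne_map_eq_of_card_lt_of_maps_to
    (s := Finset.range (K + 1)) (t := W) (by simp [K]) (f := fun r => col (n + j₀ + r * D))
    (fun r _ => hcol _ (by nlinarith [Nat.zero_le (r * D)]))
  have key : ∀ r ∈ Finset.range (K + 1), ∀ r' ∈ Finset.range (K + 1), r < r' →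
      col (n + j₀ + r * D) = col (n + j₀ + r' * D) →
      f (n + j₀) ≤ (∑ τ ∈ T, (J τ).indicator f) (n + j₀) := by
    intro r hr r' hr' hlt heq
    have hT : ((r, r'), col (n + j₀ + r * D)) ∈ T := by
      simp only [T, Finset.mem_filter, Finset.mem_product]
      exact ⟨⟨⟨hr, hr'⟩, hcol _ (by nlinarith [Nat.zero_le (r * D)])⟩, hlt⟩
    rw [Finset.sum_apply]
    refine le_trans (le_of_eq ?_) (Finset.single_le_sum (fun τ _ => hnn τ _) hT)
    rw [Set.indicator_of_mem]
    exact ⟨by omega, rfl, heq.symm⟩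
  rcases lt_or_gt_of_ne hne with h | h
  · exact key r hr r' hr' h heq
  · exact key r' hr' r hr h heq.symm

/-- Each logarithmic window of primes has a proportional share of the reciprocal sum. -/
def WindowLowerBound : Prop :=
  ∀ ε : ℝ, 0 < ε → ∃ c : ℝ, 0 < c ∧
    ∀ᶠ j : ℕ in atTop, c / j ≤ ∑ p ∈ primeWindow ε j, 1 / (p : ℝ)

/-- Some value of a takes at least the average share 1 / |W| of a window's reciprocal sum. -/
theorem exists_dominant_colour (hwin : WindowLowerBound) {a : ℕ → ℕ} {W : Finset ℕ}
    (hW : ∀ p : ℕ, p.Prime → a p ∈ W) {ε : ℝ} (hε : 0 < ε) :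
    ∃ c : ℝ, 0 < c ∧ ∃ (j₀ : ℕ) (col : ℕ → ℕ), ∀ i, j₀ ≤ i → col i ∈ W ∧
      c / i ≤ ∑ p ∈ (primeWindow ε i).filter (a · = col i), 1 / (p : ℝ) := by
  obtain ⟨c, hc, hj⟩ := hwin ε hε
  obtain ⟨j₀, hj₀⟩ := eventually_atTop.1 hj
  have hWne : W.Nonempty := ⟨_, hW 2 Nat.prime_two⟩
  have hK : (0 : ℝ) < W.card := by exact_mod_cast hWne.card_pos
  have : ∀ i, ∃ w, j₀ ≤ i → w ∈ W ∧
      c / W.card / i ≤ ∑ p ∈ (primeWindow ε i).filter (a · = w), 1 / (p : ℝ) := by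
    intro i
    by_cases hi : j₀ ≤ i
    · obtain ⟨w, hw, hle⟩ := Finset.exists_le_of_sum_le (s := W) hWne
        (f := fun _ => c / W.card / i)
        (g := fun w => ∑ p ∈ (primeWindow ε i).filter (a · = w), 1 / (p : ℝ)) (by
          rw [Finset.sum_fiberwise_of_maps_to (fun p hp => hW p ((mem_primeWindow hε).1 hp).1)]
          refine le_trans (le_of_eq ?_) (hj₀ i hi)
          rw [Finset.sum_const, nsmul_eq_mul]
          field_simp)
      exact ⟨w, fun _ => ⟨hw, hle⟩⟩
    · exact ⟨0, fun h => absurd h hi⟩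
  choose col hcol using this
  exact ⟨c / W.card, by positivity, j₀, col, hcol⟩

/-- With ε = h / D, moving by r D windows rescales by exactly e^{rh}. Equal colours and equal
weights on two translated families make the two window averages literally equal after rescaling. The
bound r ≤ |W| does not depend on η, which permits the later iteration. -/
theorem exists_shift_almost_invariant (hwin : WindowLowerBound) {a : ℕ → ℕ}
    (ha : CompletelyAdditive a) {W : Finset ℕ} (hW : ∀ p : ℕ, p.Prime → a p ∈ W) {F : ℕ → ℂ}
    (hF : ∀ k, ‖F k‖ ≤ 1) {h : ℝ} (hh : 0 < h) {η : ℝ} (hη : 0 < η) :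
    ∃ r : ℕ, 0 < r ∧ r ≤ W.card ∧ ∀ᶠ x : ℝ in atTop,
      ‖meanUpTo (fun m => F (a m)) x - meanUpTo (fun m => F (a m)) (x * Real.exp (r * h))‖ ≤ η := by
  obtain ⟨D, hD⟩ := exists_nat_gt (12 * h / η)
  have hD0 : (0 : ℝ) < D := lt_trans (by positivity) hD
  set ε := h / D
  have hε : 0 < ε := by positivity
  have hε' : 3 * ε ≤ η / 4 := by
    simp only [ε]
    rw [div_lt_iff₀ hη] at hD
    rw [mul_div_assoc', div_le_iff₀ hD0]; linarith
  have hεD : ε * D = h := div_mul_cancel₀ _ hD0.ne'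
  obtain ⟨c, hc, j₀, col, hcol⟩ := exists_dominant_colour hwin hW hε
  set K := W.card
  -- One weight below c / (j + r D) for all r ≤ K at once, and still of harmonic size.
  set f : ℕ → ℝ := fun j => c / (j + 1 + K * D : ℕ)
  have hf0 : ∀ n, 0 ≤ f n := fun n => by positivity
  have hfs : ¬ Summable f := by
    intro hs
    have h1 : Summable fun n : ℕ => (1 : ℝ) / ((n + (1 + K * D) : ℕ) : ℝ) := by
      refine (hs.mul_left c⁻¹).congr fun n => ?_
      simp only [f, ← add_assoc]
      field_simp
    exact Real.not_summable_one_div_natCast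
      ((summable_nat_add_iff (f := fun n : ℕ => (1 : ℝ) / n) (1 + K * D)).1 h1)
  -- Starting at j₀ + 1 keeps j positive, so c / (j + r D) has a positive denominator.
  obtain ⟨r₁, r₂, w, hr, hrK, hns⟩ := exists_repeated_colour (j₀ := j₀ + 1)
    (fun i hi => (hcol i (by omega)).1) D hf0 hfs
  obtain ⟨J, hJ, hJL⟩ := exists_finset_sum_ge_of_not_summable hf0 hns (32 / η ^ 2)
  set L := ∑ j ∈ J, f j
  have hLpos : 0 < L := lt_of_lt_of_le (by positivity) hJL
  have hL : √(2 / L) ≤ η / 4 := by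
    rw [Real.sqrt_le_left (by positivity), div_le_iff₀ hLpos]
    rw [div_le_iff₀ (by positivity)] at hJL
    nlinarith
  have main : ∀ r, r ≤ K → (∀ j ∈ J, col (j + r * D) = w) → ∀ᶠ x : ℝ in atTop,
      ‖meanUpTo (fun m => F (a m)) x - (∑ j ∈ J, (f j : ℂ)
        * meanUpTo (fun m => F (a m + w)) (x * Real.exp (-(ε * (j + r * D))))) / L‖
        ≤ η / 2 := by
    intro r hrK hcw
    have hinj : Set.InjOn (fun j => j + r * D) (J : Set ℕ) := fun _ _ _ _ h => by simpa using h
    have := norm_meanUpTo_sub_window_average_le ha hF hε w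
      (I := J.image fun j => j + r * D) (μ := fun i => f (i - r * D)) (fun i => hf0 _) (by
        intro i hi
        obtain ⟨j, hj, rfl⟩ := Finset.mem_image.1 hi
        have hj1 := (hJ j hj).1
        have h2 := (hcol (j + r * D) (by nlinarith [Nat.zero_le (r * D)])).2
        rw [hcw j hj] at h2
        refine le_trans ?_ h2
        simp only [Nat.add_sub_cancel, f]
        gcongr
        · exact_mod_cast (by omega : 0 < j + r * D)
        · omega) (L := L) (by rw [Finset.sum_image hinj]; simp [L]) hLpos
    filter_upwards [this] with x hx
    rw [Finset.sum_image hinj] at hx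
    simp only [Nat.add_sub_cancel, Nat.cast_add, Nat.cast_mul] at hx
    linarith
  refine ⟨r₂ - r₁, by omega, by omega, ?_⟩
  have m1 := main r₁ (by omega) fun j hj => (hJ j hj).2.1
  have m2 := (tendsto_id.atTop_mul_const (Real.exp_pos (((r₂ - r₁ : ℕ) : ℝ) * h))).eventually
    (main r₂ hrK fun j hj => (hJ j hj).2.2)
  filter_upwards [m1, m2] with x hx1 hx2
  have e : ∀ j : ℕ, id x * Real.exp (((r₂ - r₁ : ℕ) : ℝ) * h) * Real.exp (-(ε * (j + r₂ * D)))
      = x * Real.exp (-(ε * (j + r₁ * D))) := by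
    intro j
    rw [mul_assoc, ← Real.exp_add, Nat.cast_sub hr.le, ← hεD, id]
    congr 2; ring
  simp only [e] at hx2
  rw [norm_sub_rev] at hx2
  exact ((norm_sub_le_norm_sub_add_norm_sub _ _ _).trans (add_le_add hx1 hx2)).trans
    (by linarith)

theorem eventually_norm_sub_iterate_le {M : ℝ → ℂ} {h η : ℝ}
    (hM : ∀ᶠ x : ℝ in atTop, ‖M x - M (x * Real.exp h)‖ ≤ η) (k : ℕ) :
    ∀ᶠ x : ℝ in atTop, ‖M x - M (x * Real.exp (k * h))‖ ≤ k * η := by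
  induction k with
  | zero => simp
  | succ k ih =>
    filter_upwards [ih, (tendsto_id.atTop_mul_const (Real.exp_pos (k * h))).eventually hM]
      with x h1 h2
    refine (norm_sub_le_norm_sub_add_norm_sub _ (M (x * Real.exp (k * h))) _).trans ?_
    rw [id, mul_assoc, ← Real.exp_add, show k * h + h = ((k + 1 : ℕ) : ℝ) * h by push_cast; ring]
      at h2
    push_cast at h2 ⊢
    linarith

/-- Means of functions of a completely additive function with finitely many values on the primes
do not oscillate under a change of scale. -/
theorem tendsto_meanUpTo_sub_scale (hwin : WindowLowerBound) {a : ℕ → ℕ}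
    (ha : CompletelyAdditive a) (hfin : (a '' {p : ℕ | p.Prime}).Finite) {F : ℕ → ℂ}
    (hF : ∀ k, ‖F k‖ ≤ 1) {H : ℝ} (hH : 0 < H) :
    Tendsto (fun x : ℝ => meanUpTo (fun m => F (a m)) x
      - meanUpTo (fun m => F (a m)) (x * Real.exp H)) atTop (𝓝 0) := by
  set W := hfin.toFinset
  have hW : ∀ p : ℕ, p.Prime → a p ∈ W := fun p hp => by
    simp only [W, Set.Finite.mem_toFinset]; exact ⟨p, hp, rfl⟩
  -- Only r ≤ |W| is known; with h = H / |W|! every admissible r has r h dividing H, and at most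
  -- |W|! iterations are needed.
  set R := W.card.factorial
  have hR : (0 : ℝ) < R := by exact_mod_cast Nat.factorial_pos _
  rw [Metric.tendsto_nhds]
  intro δ hδ
  obtain ⟨r, hr0, hrK, hr⟩ := exists_shift_almost_invariant hwin ha hW hF
    (h := H / R) (by positivity) (η := δ / (2 * R)) (by positivity)
  obtain ⟨k, hk⟩ : r ∣ R := Nat.dvd_factorial hr0 hrK
  filter_upwards [eventually_norm_sub_iterate_le hr k] with x hx
  have hkr : (R : ℝ) = r * k := by exact_mod_cast hk
  have hk0 : (k : ℝ) ≤ R := by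
    exact_mod_cast Nat.le_of_dvd (Nat.factorial_pos _) ⟨r, by rw [mul_comm]; exact hk⟩
  rw [show (k : ℝ) * (r * (H / R)) = H by
    rw [← mul_assoc, mul_comm (k : ℝ), ← hkr]; field_simp] at hx
  rw [dist_zero_right]
  refine hx.trans_lt ?_
  calc k * (δ / (2 * R)) ≤ R * (δ / (2 * R)) := by gcongr
    _ = δ / 2 := by field_simp
    _ < δ := by linarith

theorem tendsto_meanUpTo_div_sub (hwin : WindowLowerBound) {a : ℕ → ℕ}
    (ha : CompletelyAdditive a) (hfin : (a '' {p : ℕ | p.Prime}).Finite) {F : ℕ → ℂ}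
    (hF : ∀ k, ‖F k‖ ≤ 1) {p : ℕ} (hp : 1 < p) :
    Tendsto (fun x : ℝ => meanUpTo (fun m => F (a m)) (x / p)
      - meanUpTo (fun m => F (a m)) x) atTop (𝓝 0) := by
  have hp0 : (0 : ℝ) < p := by positivity
  have := (tendsto_meanUpTo_sub_scale hwin ha hfin hF
    (Real.log_pos (by exact_mod_cast hp : (1 : ℝ) < p))).comp (tendsto_id.atTop_div_const hp0)
  refine this.congr fun x => ?_
  simp only [Function.comp, id, Real.exp_log hp0, div_mul_cancel₀ _ hp0.ne']

/-! ### Invariance of means under the shift by v. -/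

/-- If the primes with `a p = v` have divergent reciprocal sum, then shifting by `v` does not
change means along `a`. -/
theorem tendsto_meanUpTo_sub_shift_of_norm_le_one (hwin : WindowLowerBound) {a : ℕ → ℕ}
    (ha : CompletelyAdditive a) (hfin : (a '' {p : ℕ | p.Prime}).Finite) {v : ℕ}
    (hv : ReciprocalSumDiverges {p : ℕ | p.Prime ∧ a p = v}) {F : ℕ → ℂ} (hF : ∀ k, ‖F k‖ ≤ 1) :
    Tendsto (fun x : ℝ => meanUpTo (fun m => F (a m)) x
      - meanUpTo (fun m => F (a m + v)) x) atTop (𝓝 0) := by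
  rw [Metric.tendsto_nhds]
  intro δ hδ
  obtain ⟨P, hP, hPL⟩ := exists_finset_sum_ge_of_not_summable (fun n => by positivity) hv
    (8 / δ ^ 2 + 1)
  set L := ∑ p ∈ P, 1 / (p : ℝ)
  have hL0 : 0 < L := lt_of_lt_of_le (by positivity) hPL
  have hL : √(2 / L) < δ / 2 := by
    rw [Real.sqrt_lt' (by positivity), div_lt_iff₀ hL0]
    have h1 : 8 / δ ^ 2 < L := by linarith
    rw [div_lt_iff₀ (by positivity)] at h1
    nlinarith
  have hLC : (L : ℂ) ≠ 0 := by exact_mod_cast hL0.ne'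
  -- P is a fixed finite set, so scale invariance for F(· + v) replaces each x/p by x in the limit.
  have hlim : Tendsto (fun x : ℝ => (∑ p ∈ P, ((1 / p : ℝ) : ℂ)
      * (meanUpTo (fun m => F (a m + v)) (x / p) - meanUpTo (fun m => F (a m + v)) x)) / L)
      atTop (𝓝 0) := by
    have : Tendsto (fun x : ℝ => (∑ p ∈ P, ((1 / p : ℝ) : ℂ)
      * (meanUpTo (fun m => F (a m + v)) (x / p) - meanUpTo (fun m => F (a m + v)) x)) / L)
      atTop (𝓝 ((∑ p ∈ P, ((1 / p : ℝ) : ℂ) * 0) / L)) := by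
      refine (tendsto_finsetSum _ fun p hp => ?_).div_const _
      exact (tendsto_meanUpTo_div_sub hwin ha hfin (F := fun k => F (k + v)) (fun k => hF _)
        (hP p hp).1.one_lt).const_mul _
    simpa using this
  filter_upwards [(Metric.tendsto_nhds.1 hlim) (δ / 2) (by positivity), eventually_gt_atTop 0,
    eventually_ge_atTop (2 * (P.card : ℝ))] with x hx hx0 hxP
  have h1 := norm_meanUpTo_sub_prime_average_le (fun p hp => (hP p hp).1) (c := fun _ => 1)
    (fun _ => zero_le_one) (fun _ => le_rfl) (P := P) (L := L) rfl hL0 (G := fun m => F (a m))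
    (fun n => hF _) hx0 hxP
  have h2 : ∑ p ∈ P, ((1 / p : ℝ) : ℂ) * meanUpTo (fun m => F (a (p * m))) (x / p)
      = ∑ p ∈ P, ((1 / p : ℝ) : ℂ) * meanUpTo (fun m => F (a m + v)) (x / p) := by
    refine Finset.sum_congr rfl fun p hp => ?_
    congr 1
    refine meanUpTo_congr (fun n hn => ?_) _
    rw [ha p n (hP p hp).1.ne_zero hn, (hP p hp).2, add_comm]
  rw [h2] at h1
  rw [dist_zero_right] at hx ⊢
  have h3 : (∑ p ∈ P, ((1 / p : ℝ) : ℂ)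
      * (meanUpTo (fun m => F (a m + v)) (x / p) - meanUpTo (fun m => F (a m + v)) x)) / L
      = (∑ p ∈ P, ((1 / p : ℝ) : ℂ) * meanUpTo (fun m => F (a m + v)) (x / p)) / L
        - meanUpTo (fun m => F (a m + v)) x := by
    simp only [mul_sub, Finset.sum_sub_distrib]
    rw [sub_div, ← Finset.sum_mul, ← Complex.ofReal_sum, mul_comm (Complex.ofReal _),
      mul_div_cancel_right₀ _ hLC]
  rw [h3] at hx
  refine (norm_sub_le_norm_sub_add_norm_sub _ _ _).trans_lt (add_lt_add_of_le_of_lt h1 hx) |>.trans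
    (by linarith)

theorem tendsto_meanUpTo_sub_shift (hwin : WindowLowerBound) {a : ℕ → ℕ}
    (ha : CompletelyAdditive a) (hfin : (a '' {p : ℕ | p.Prime}).Finite) {v : ℕ}
    (hv : ReciprocalSumDiverges {p : ℕ | p.Prime ∧ a p = v}) {F : ℕ → ℂ} {C : ℝ}
    (hF : ∀ k, ‖F k‖ ≤ C) :
    Tendsto (fun x : ℝ => meanUpTo (fun m => F (a m)) x
      - meanUpTo (fun m => F (a m + v)) x) atTop (𝓝 0) := by
  set B : ℝ := max C 1
  have hB : 0 < B := by positivity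
  have hBC : (B : ℂ) ≠ 0 := by exact_mod_cast hB.ne'
  have := (tendsto_meanUpTo_sub_shift_of_norm_le_one hwin ha hfin hv (F := fun k => F k / B)
    (fun k => by
      rw [norm_div, Complex.norm_real, Real.norm_of_nonneg hB.le]
      exact div_le_one_of_le₀ ((hF k).trans (le_max_left _ _)) hB.le)).const_mul (B : ℂ)
  rw [mul_zero] at this
  refine this.congr fun x => ?_
  simp only [meanUpTo, ← Finset.sum_div]
  field_simp

/-! ### Empirical measures and equidistribution. -/

theorem meanUpTo_natCast (G : ℕ → ℂ) (N : ℕ) :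
    meanUpTo G N = (1 / (N : ℂ)) * ∑ n ∈ Finset.Icc 1 N, G n := by
  rw [meanUpTo, Nat.floor_natCast, Complex.ofReal_natCast, div_eq_mul_inv, mul_comm, one_div]

/-- The uniform probability measure on the points `u 1, …, u (N + 1)`. -/
noncomputable def empiricalMeasure {X : Type*} [MeasurableSpace X] (u : ℕ → X) (N : ℕ) :
    Measure X :=
  ∑ n ∈ Finset.Icc 1 (N + 1), ((N + 1 : ℕ) : ENNReal)⁻¹ • Measure.dirac (u n)

theorem isProbabilityMeasure_empiricalMeasure {X : Type*} [MeasurableSpace X] (u : ℕ → X) (N : ℕ) :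
    IsProbabilityMeasure (empiricalMeasure u N) := by
  constructor
  rw [empiricalMeasure, Measure.finsetSum_apply]
  simp only [Measure.smul_apply, measure_univ, smul_eq_mul, mul_one, Finset.sum_const,
    Nat.card_Icc, Nat.add_sub_cancel, nsmul_eq_mul]
  exact ENNReal.mul_inv_cancel (by simp) (ENNReal.natCast_ne_top _)

theorem integral_empiricalMeasure {X : Type*} [TopologicalSpace X] [CompactSpace X]
    [MeasurableSpace X] [BorelSpace X] (u : ℕ → X) (N : ℕ) (f : C(X, ℂ)) :
    ∫ y, f y ∂(empiricalMeasure u N) = meanUpTo (fun n => f (u n)) ((N + 1 : ℕ) : ℝ) := by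
  have hm : StronglyMeasurable f := f.continuous.stronglyMeasurable_of_hasCompactSupport
    (HasCompactSupport.of_compactSpace _)
  have hi : ∀ n, Integrable f (((N + 1 : ℕ) : ENNReal)⁻¹ • Measure.dirac (u n)) := fun n =>
    (f.continuous.integrable_of_hasCompactSupport
      (HasCompactSupport.of_compactSpace _)).smul_measure (by simp)
  rw [meanUpTo_natCast, empiricalMeasure, integral_finsetSum_measure fun n _ => hi n,
    Finset.mul_sum]
  refine Finset.sum_congr rfl fun n _ => ?_
  rw [integral_smul_measure, integral_dirac' _ _ hm, ENNReal.toReal_inv, ENNReal.toReal_natCast,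
    Complex.real_smul]
  push_cast
  rw [one_div]

theorem exists_value_diverges {a : ℕ → ℕ} (hfin : (a '' {p : ℕ | p.Prime}).Finite)
    (hdiv : ReciprocalSumDiverges {p : ℕ | p.Prime ∧ a p ≠ 0}) :
    ∃ v, v ≠ 0 ∧ ReciprocalSumDiverges {p : ℕ | p.Prime ∧ a p = v} := by
  classical
  by_contra! hcon
  simp only [ReciprocalSumDiverges, not_not] at hcon
  set V := hfin.toFinset.filter (· ≠ 0)
  have hs : Summable fun n => ∑ v ∈ V,
      ({p : ℕ | p.Prime ∧ a p = v}.indicator (fun p : ℕ => 1 / (p : ℝ))) n :=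
    summable_sum fun v hv => hcon v (Finset.mem_filter.1 hv).2
  refine hdiv (Summable.of_nonneg_of_le (fun n => Set.indicator_nonneg (fun _ _ => by positivity) _)
    (fun n => ?_) hs)
  have hnn : ∀ v, 0 ≤ ({p : ℕ | p.Prime ∧ a p = v}.indicator (fun p : ℕ => 1 / (p : ℝ))) n :=
    fun v => Set.indicator_nonneg (fun _ _ => by positivity) _
  by_cases hn : n ∈ {p : ℕ | p.Prime ∧ a p ≠ 0}
  · have hV : a n ∈ V := Finset.mem_filter.2
      ⟨(Set.Finite.mem_toFinset hfin).2 ⟨n, hn.1, rfl⟩, hn.2⟩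
    refine le_trans (le_of_eq ?_) (Finset.single_le_sum (fun v _ => hnn v) hV)
    rw [Set.indicator_of_mem hn, Set.indicator_of_mem]
    exact ⟨hn.1, rfl⟩
  · rw [Set.indicator_of_notMem hn]
    exact Finset.sum_nonneg fun v _ => hnn v

/-- If the means of every continuous function along `u` are asymptotically `S`-invariant and `S` is
uniquely ergodic, then `u` is equidistributed. -/
theorem tendsto_mean_of_asymptotically_invariant {X : Type*} [MetricSpace X] [CompactSpace X]
    [MeasurableSpace X] [BorelSpace X] {μ : Measure X} {S : X → X} (hS : UniquelyErgodic μ S)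
    (u : ℕ → X)
    (hu : ∀ f : C(X, ℂ), Tendsto (fun x : ℝ => meanUpTo (fun n => f (u n)) x
      - meanUpTo (fun n => f (S (u n))) x) atTop (𝓝 0)) (f : C(X, ℂ)) :
    Tendsto (fun N : ℕ => (1 / (N : ℂ)) * ∑ n ∈ Finset.Icc 1 N, f (u n)) atTop
      (𝓝 (∫ y, f y ∂μ)) := by
  have := hS.isProbabilityMeasure
  set ν : ℕ → ProbabilityMeasure X := fun N =>
    ⟨empiricalMeasure u N, isProbabilityMeasure_empiricalMeasure u N⟩
  have hν : ∀ (g : C(X, ℂ)) N, ∫ y, g y ∂(ν N : Measure X)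
      = meanUpTo (fun n => g (u n)) ((N + 1 : ℕ) : ℝ) := fun g N =>
    integral_empiricalMeasure u N g
  have hcast : Tendsto (fun N : ℕ => ((N + 1 : ℕ) : ℝ)) atTop atTop :=
    tendsto_natCast_atTop_atTop.comp (tendsto_add_atTop_nat 1)
  have hlim : ∀ (ρ : ProbabilityMeasure X) (U : Filter ℕ), Tendsto ν U (𝓝 ρ) → ∀ g : C(X, ℂ),
      Tendsto (fun N => ∫ y, g y ∂(ν N : Measure X)) U (𝓝 (∫ y, g y ∂(ρ : Measure X))) :=
    fun ρ U h g => (ProbabilityMeasure.tendsto_iff_forall_integral_rclike_tendsto ℂ).1 h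
      (BoundedContinuousFunction.mkOfCompact g)
  have hconv : Tendsto ν atTop (𝓝 ⟨μ, inferInstance⟩) := by
    -- Probability measures on X form a compact space, so it suffices that every cluster point ρ is
    -- S-invariant; this is tested on real continuous functions along an ultrafilter converging to
    -- ρ.
    refine le_nhds_of_unique_clusterPt fun ρ hρ => ?_
    obtain ⟨U, hU, hUρ⟩ := mapClusterPt_iff_ultrafilter.1 (show MapClusterPt ρ atTop ν from hρ)
    refine Subtype.ext (hS.unique ρ inferInstance ⟨hS.continuous.measurable, ?_⟩)
    have : IsProbabilityMeasure (Measure.map S (ρ : Measure X)) :=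
      Measure.isProbabilityMeasure_map hS.continuous.aemeasurable
    refine ext_of_forall_integral_eq_of_IsFiniteMeasure fun g => ?_
    set gC : C(X, ℂ) := ⟨fun y => (g y : ℂ), by fun_prop⟩
    set gS : C(X, ℂ) := ⟨fun y => (g (S y) : ℂ), by have := hS.continuous; fun_prop⟩
    have h1 := (hlim ρ U hUρ gC).sub (hlim ρ U hUρ gS)
    have h2 : Tendsto (fun N => ∫ y, gC y ∂(ν N : Measure X) - ∫ y, gS y ∂(ν N : Measure X)) U
        (𝓝 0) := by
      refine Tendsto.mono_left ?_ hU
      simp only [hν]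
      exact (hu gC).comp hcast
    have h3 := sub_eq_zero.1 (tendsto_nhds_unique h1 h2)
    simp only [gC, gS, ContinuousMap.coe_mk, integral_complex_ofReal] at h3
    rw [integral_map hS.continuous.aemeasurable
      g.continuous.stronglyMeasurable.aestronglyMeasurable]
    exact_mod_cast h3.symm
  have := hlim _ _ hconv f
  simp only [hν, meanUpTo_natCast] at this
  exact (tendsto_add_atTop_iff_nat 1).1 this

theorem tendsto_mean_of_uniquelyErgodic (hwin : WindowLowerBound) {X : Type*} [MetricSpace X]
    [CompactSpace X] [MeasurableSpace X] [BorelSpace X] {μ : Measure X} {T : X → X}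
    {a : ℕ → ℕ} (ha : CompletelyAdditive a)
    (hfin : (a '' {p : ℕ | p.Prime}).Finite)
    (hdiv : ReciprocalSumDiverges {p : ℕ | p.Prime ∧ a p ≠ 0})
    (hue : ∀ p : ℕ, p.Prime → a p ≠ 0 → UniquelyErgodic μ (T^[a p])) (f : C(X, ℂ)) (x : X) :
    Tendsto (fun N : ℕ => (1 / (N : ℂ)) * ∑ n ∈ Finset.Icc 1 N, f (T^[a n] x)) atTop
      (𝓝 (∫ y, f y ∂μ)) := by
  obtain ⟨v, hv0, hv⟩ := exists_value_diverges hfin hdiv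
  obtain ⟨p, hp, hpv⟩ : ∃ p : ℕ, p.Prime ∧ a p = v := by
    by_contra! hcon
    refine hv ?_
    rw [show {p : ℕ | p.Prime ∧ a p = v} = ∅ from
      Set.eq_empty_iff_forall_notMem.2 fun p hp => hcon p hp.1 hp.2, Set.indicator_empty]
    exact summable_zero
  have hS : UniquelyErgodic μ (T^[v]) := hpv ▸ hue p hp (hpv ▸ hv0)
  refine tendsto_mean_of_asymptotically_invariant hS (fun n => T^[a n] x) (fun g => ?_) f
  refine (tendsto_meanUpTo_sub_shift hwin ha hfin hv (F := fun k => g (T^[k] x)) (C := ‖g‖)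
    fun k => g.norm_coe_le_norm _).congr fun y => ?_
  simp only [← Function.iterate_add_apply, add_comm v]

/-! ### The Liouville variant. -/

theorem bigOmegaIn_mul (Q : Set ℕ) {m n : ℕ} (hm : m ≠ 0) (hn : n ≠ 0) :
    bigOmegaIn Q (m * n) = bigOmegaIn Q m + bigOmegaIn Q n := by
  classical
  have key : ∀ k l : ℕ, k ≠ 0 → l ≠ 0 → bigOmegaIn Q k
      = ∑ p ∈ (k * l).primeFactors with p ∈ Q, k.factorization p := by
    intro k l hk hl
    unfold bigOmegaIn
    refine (Finset.sum_subset_zero_on_sdiff ?_ (fun p hp => ?_) fun p _ => rfl)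
    · intro p hp
      simp only [Finset.mem_filter, Nat.mem_primeFactors] at hp ⊢
      exact ⟨⟨hp.1.1, hp.1.2.1.mul_right _, mul_ne_zero hk hl⟩, hp.2⟩
    · simp only [Finset.mem_sdiff, Finset.mem_filter, not_and] at hp
      exact Finsupp.notMem_support_iff.1 fun h => hp.2 h hp.1.2
  rw [key m n hm hn, key n m hn hm, mul_comm n m, ← Finset.sum_add_distrib]
  unfold bigOmegaIn
  refine Finset.sum_congr (by congr) fun p _ => ?_
  rw [Nat.factorization_mul hm hn, Finsupp.add_apply]

theorem bigOmegaIn_prime (Q : Set ℕ) [DecidablePred (· ∈ Q)] {p : ℕ} (hp : p.Prime) :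
    bigOmegaIn Q p = if p ∈ Q then 1 else 0 := by
  classical
  unfold bigOmegaIn
  rw [hp.primeFactors, Finset.filter_singleton]
  split_ifs <;> simp [hp.factorization_self]

theorem tendsto_mean_liouvilleIn (hwin : WindowLowerBound) {Q : Set ℕ} (hQ : ∀ p ∈ Q, p.Prime)
    (hdiv : ReciprocalSumDiverges Q) :
    Tendsto (fun N : ℕ => (1 / (N : ℝ)) * ∑ n ∈ Finset.Icc 1 N, liouvilleIn Q n) atTop
      (𝓝 0) := by
  classical
  have hfin : (bigOmegaIn Q '' {p : ℕ | p.Prime}).Finite := by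
    refine (Set.toFinite {0, 1}).subset ?_
    rintro _ ⟨p, hp, rfl⟩
    rw [bigOmegaIn_prime Q hp]
    split_ifs <;> simp
  have hset : {p : ℕ | p.Prime ∧ bigOmegaIn Q p = 1} = Q := by
    ext p
    constructor
    · rintro ⟨hp, h⟩
      rw [bigOmegaIn_prime Q hp] at h
      by_contra hpQ
      simp [hpQ] at h
    · intro hp
      exact ⟨hQ p hp, by rw [bigOmegaIn_prime Q (hQ p hp), if_pos hp]⟩
  have h := tendsto_meanUpTo_sub_shift hwin (a := bigOmegaIn Q)
    (fun m n hm hn => bigOmegaIn_mul Q hm hn) hfin (v := 1)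
    (by rw [hset]; exact hdiv) (F := fun k => (-1) ^ k) (C := 1) (fun k => by simp)
  -- Since (−1)^{k+1} = −(−1)^k, the shift difference is twice the mean.
  have h2 : Tendsto (fun N : ℕ => meanUpTo (fun m => (-1) ^ bigOmegaIn Q m) N) atTop (𝓝 0) := by
    have := (h.comp tendsto_natCast_atTop_atTop).const_mul (1 / 2 : ℂ)
    rw [mul_zero] at this
    refine this.congr fun N => ?_
    simp only [Function.comp, meanUpTo, pow_succ, mul_neg, mul_one, Finset.sum_neg_distrib]
    ring
  rw [← Complex.ofReal_zero] at h2
  simp only [meanUpTo_natCast] at h2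
  refine (Complex.continuous_re.tendsto _).comp h2 |>.congr fun N => ?_
  rw [Function.comp, ← Complex.ofReal_re (_ * _)]
  simp only [liouvilleIn]
  push_cast
  rfl

/-! ### Positive relative density implies a divergent reciprocal sum. -/

theorem sum_range_inv_two_pow_le {p : ℕ} (hp : 0 < p) (K : ℕ) :
    ∑ k ∈ Finset.range K, (if p ≤ 2 ^ k then (1 : ℝ) / 2 ^ k else 0) ≤ 2 / p := by
  have hp0 : (0 : ℝ) < p := by exact_mod_cast hp
  -- The subtracted 2 / 2^K makes the geometric sum inductive; the maximum with 0 covers the range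
  -- before 2^k reaches p.
  have key : ∑ k ∈ Finset.range K, (if p ≤ 2 ^ k then (1 : ℝ) / 2 ^ k else 0)
      ≤ max (0 : ℝ) (2 / (p : ℝ) - 2 / (2 : ℝ) ^ K) := by
    induction K with
    | zero => simp
    | succ K ih =>
      rw [Finset.sum_range_succ]
      have e : (2 : ℝ) / 2 ^ (K + 1) = 1 / 2 ^ K := by rw [pow_succ]; field_simp
      split_ifs with h
      · have h1 : (2 : ℝ) / 2 ^ K ≤ 2 / p := by
          have : (p : ℝ) ≤ 2 ^ K := by exact_mod_cast h
          gcongr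
        rw [max_eq_right (by linarith)] at ih
        refine le_max_of_le_right ?_
        have h2 : (2 : ℝ) / 2 ^ K = 1 / 2 ^ K + 1 / 2 ^ K := by ring
        rw [e]; linarith
      · rw [add_zero]
        refine ih.trans (max_le_max le_rfl ?_)
        gcongr
        · norm_num
        · omega
  exact key.trans (max_le (by positivity) (by linarith [show (0 : ℝ) ≤ 2 / 2 ^ K by positivity]))

/-- Exchange the sums: each p ∈ Q contributes the geometric tail over 2^k ≥ p, at most 2/p. Relative
density would make these terms at least a multiple of 1/k. -/
theorem summable_dyadic_count_of_summable {Q : Set ℕ}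
    (h : Summable (Q.indicator fun p : ℕ => 1 / (p : ℝ))) :
    Summable fun k : ℕ => ((Q ∩ Set.Icc 1 (2 ^ k)).ncard : ℝ) / 2 ^ k := by
  classical
  have hcount : ∀ k K : ℕ, k < K → ((Q ∩ Set.Icc 1 (2 ^ k)).ncard : ℝ) / 2 ^ k
      = ∑ p ∈ (Finset.Icc 1 (2 ^ K)).filter (· ∈ Q), if p ≤ 2 ^ k then (1 : ℝ) / 2 ^ k else 0 := by
    intro k K hk
    have : Q ∩ Set.Icc 1 (2 ^ k)
        = (((Finset.Icc 1 (2 ^ K)).filter (· ∈ Q)).filter (· ≤ 2 ^ k) : Finset ℕ) := by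
      ext p
      have : 2 ^ k ≤ 2 ^ K := Nat.pow_le_pow_right two_pos hk.le
      simp only [Set.mem_inter_iff, Set.mem_Icc, Finset.coe_filter, Finset.mem_filter,
        Finset.mem_Icc, Set.mem_ofPred_eq]
      constructor
      · rintro ⟨h1, h2, h3⟩; exact ⟨⟨⟨h2, h3.trans this⟩, h1⟩, h3⟩
      · rintro ⟨⟨⟨h1, _⟩, h2⟩, h3⟩; exact ⟨h2, h1, h3⟩
    rw [this, Set.ncard_coe_finset, ← Finset.sum_filter, Finset.sum_const, nsmul_eq_mul,
      mul_one_div]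
  refine summable_of_sum_range_le
    (c := 2 * ∑' p : ℕ, Q.indicator (fun p : ℕ => 1 / (p : ℝ)) p) (fun k => by positivity)
    fun K => ?_
  rw [Finset.sum_congr rfl fun k hk => hcount k K (Finset.mem_range.1 hk), Finset.sum_comm]
  calc _ ≤ ∑ p ∈ (Finset.Icc 1 (2 ^ K)).filter (· ∈ Q), 2 / (p : ℝ) :=
        Finset.sum_le_sum fun p hp => sum_range_inv_two_pow_le
          (Finset.mem_Icc.1 (Finset.mem_filter.1 hp).1).1 K
    _ = 2 * ∑ p ∈ (Finset.Icc 1 (2 ^ K)), Q.indicator (fun p : ℕ => 1 / (p : ℝ)) p := by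
        rw [Finset.sum_indicator_eq_sum_filter _ (fun _ => fun p : ℕ => 1 / (p : ℝ)) (fun _ => Q)
          (fun n => n), Finset.mul_sum]
        exact Finset.sum_congr rfl fun p _ => by ring
    _ ≤ _ := by
        gcongr
        exact h.sum_le_tsum _ fun p _ => Set.indicator_nonneg (fun _ _ => by positivity) _

theorem reciprocalSumDiverges_of_hasRelativePrimeDensity {Q : Set ℕ} {τ : ℝ} (hτ : 0 < τ)
    (h : HasRelativePrimeDensity Q τ) : ReciprocalSumDiverges Q := by
  intro hs
  have h1 : ∀ᶠ n : ℕ in atTop, τ / 2 * (n / Real.log n) ≤ ((Q ∩ Set.Icc 1 n).ncard : ℝ) := by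
    have hlo := h.isLittleO.bound (show (0 : ℝ) < 1 / 2 by norm_num)
    filter_upwards [hlo, eventually_ge_atTop 2] with n hn h2
    have hlog : 0 < Real.log n := Real.log_pos (by exact_mod_cast (by omega : 1 < n))
    have hpos : 0 ≤ τ * n / Real.log n := by positivity
    rw [Pi.sub_apply, Real.norm_eq_abs, Real.norm_of_nonneg hpos] at hn
    have := (abs_le.1 hn).1
    have e : τ / 2 * (n / Real.log n) = 1 / 2 * (τ * n / Real.log n) := by ring
    linarith
  have h2 := (tendsto_pow_atTop_atTop_of_one_lt (r := 2) one_lt_two).eventually h1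
  have hl2 : 0 < Real.log 2 := Real.log_pos one_lt_two
  have h3 : ∀ᶠ k : ℕ in atTop, ‖(1 : ℝ) / k‖ ≤ 2 * Real.log 2 / τ *
      (((Q ∩ Set.Icc 1 (2 ^ k)).ncard : ℝ) / 2 ^ k) := by
    filter_upwards [h2, eventually_gt_atTop 0] with k hk hk0
    have hk0' : (0 : ℝ) < k := by exact_mod_cast hk0
    rw [Real.norm_of_nonneg (by positivity)]
    push_cast at hk
    rw [Real.log_pow] at hk
    have : τ / 2 * (1 / (k * Real.log 2)) ≤ ((Q ∩ Set.Icc 1 (2 ^ k)).ncard : ℝ) / 2 ^ k := by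
      rw [le_div_iff₀ (by positivity)]
      refine le_trans (le_of_eq ?_) hk
      ring
    calc (1 : ℝ) / k = 2 * Real.log 2 / τ * (τ / 2 * (1 / (k * Real.log 2))) := by field_simp
      _ ≤ _ := by gcongr
  exact Real.not_summable_one_div_natCast (Summable.of_norm_bounded_eventually_nat
    ((summable_dyadic_count_of_summable hs).mul_left _) h3)

/-! ### Boundary behaviour of the Dirichlet series of Λ − 1. -/

open ArithmeticFunction in
/-- The continuation of `∑ (Λ n - 1) n ^ (-s)` to the closed half-plane `1 ≤ re s`. -/
noncomputable def vonMangoldtSubOneSeries (s : ℂ) : ℂ :=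
  vonMangoldt.LFunctionResidueClassAux (1 : ZMod 1) s
    - Function.update (fun s => riemannZeta s - 1 / (s - 1)) 1 (Real.eulerMascheroniConstant : ℂ) s

/-- Both −ζ'/ζ and ζ have residue 1 at s = 1, and each is continuous on Re s ≥ 1 once its pole is
removed. For the former this rests on the nonvanishing of ζ on Re s = 1, contained in
`continuousOn_LFunctionResidueClassAux`. -/
theorem continuousOn_vonMangoldtSubOneSeries :
    ContinuousOn vonMangoldtSubOneSeries {s | 1 ≤ s.re} := by
  refine (ArithmeticFunction.vonMangoldt.continuousOn_LFunctionResidueClassAux _).sub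
    (Continuous.continuousOn ?_)
  rw [continuous_iff_continuousAt]
  intro s
  rcases eq_or_ne s 1 with rfl | hs
  · exact continuousAt_update_same.2 tendsto_riemannZeta_sub_one_div
  · rw [continuousAt_update_of_ne hs]
    exact (differentiableAt_riemannZeta hs).continuousAt.sub
      (continuousAt_const.div (continuousAt_id.sub continuousAt_const) (sub_ne_zero.2 hs))

/-- The coefficients `Λ n - 1`. -/
noncomputable def vonMangoldtSubOne (n : ℕ) : ℝ := ArithmeticFunction.vonMangoldt n - 1

theorem hasSum_vonMangoldtSubOneSeries {s : ℂ} (hs : 1 < s.re) :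
    HasSum (fun n => LSeries.term (fun n => (vonMangoldtSubOne n : ℂ)) s n)
      (vonMangoldtSubOneSeries s) := by
  have hs1 : s ≠ 1 := fun h => by simp [h] at hs
  have h1 := (ArithmeticFunction.LSeriesSummable_vonMangoldt hs)
  have h2 : LSeriesSummable 1 s := LSeriesSummable_one_iff.2 hs
  have e : vonMangoldtSubOneSeries s
      = LSeries (fun n => (ArithmeticFunction.vonMangoldt n : ℂ)) s - LSeries 1 s := by
    rw [vonMangoldtSubOneSeries, ArithmeticFunction.vonMangoldt.eqOn_LFunctionResidueClassAux
      isUnit_one hs, Function.update_of_ne hs1, LSeries_one_eq_riemannZeta hs]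
    have : ArithmeticFunction.vonMangoldt.residueClass (1 : ZMod 1)
        = fun n => ArithmeticFunction.vonMangoldt n := by
      ext n
      exact Set.indicator_of_mem (s := {m : ℕ | (m : ZMod 1) = 1}) (Subsingleton.elim _ _) _
    rw [this]
    simp
  rw [e]
  refine (h1.hasSum.sub h2.hasSum).congr_fun fun n => ?_
  simp only [LSeries.term, vonMangoldtSubOne]
  split_ifs <;> simp [sub_div]

/-! ### Fejér kernel and smoothed sums of Λ − 1. -/

/-- The Fejér kernel, as a cosine transform of a triangle. -/
noncomputable def fejerKernel (z : ℝ) : ℝ := ∫ t in (0 : ℝ)..1, 2 * (1 - t) * Real.cos (t * z)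

theorem fejerKernel_eq {z : ℝ} (hz : z ≠ 0) : fejerKernel z = 2 * (1 - Real.cos z) / z ^ 2 := by
  have hd : ∀ t ∈ Set.uIcc (0 : ℝ) 1, HasDerivAt
      (fun t => 2 * ((1 - t) * Real.sin (t * z) / z - Real.cos (t * z) / z ^ 2))
      (2 * (1 - t) * Real.cos (t * z)) t := by
    intro t _
    have h0 : HasDerivAt (fun t : ℝ => t * z) z t := by
      simpa using (hasDerivAt_id t).mul_const z
    have h1 := h0.sin
    have h2 := h0.cos
    have h3 : HasDerivAt (fun t : ℝ => 1 - t) (-1) t := by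
      simpa using (hasDerivAt_id t).const_sub 1
    convert! (((h3.mul h1).div_const z).sub (h2.div_const (z ^ 2))).const_mul 2 using 1
    field_simp
    ring
  rw [fejerKernel, intervalIntegral.integral_eq_sub_of_hasDerivAt hd
    (Continuous.intervalIntegrable (by fun_prop) _ _)]
  simp
  field_simp
  ring

theorem fejerKernel_zero : fejerKernel 0 = 1 := by
  simp only [fejerKernel, mul_zero, Real.cos_zero, mul_one]
  rw [intervalIntegral.integral_const_mul, intervalIntegral.integral_sub (by simp) (by simp)]
  simp
  norm_num

theorem fejerKernel_nonneg (z : ℝ) : 0 ≤ fejerKernel z := by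
  rcases eq_or_ne z 0 with rfl | hz
  · rw [fejerKernel_zero]; exact zero_le_one
  · rw [fejerKernel_eq hz]
    have := Real.cos_le_one z
    have : 0 ≤ 1 - Real.cos z := by linarith
    positivity

theorem fejerKernel_le_one (z : ℝ) : fejerKernel z ≤ 1 := by
  rcases eq_or_ne z 0 with rfl | hz
  · rw [fejerKernel_zero]
  · rw [fejerKernel_eq hz, div_le_one (by positivity)]
    linarith [Real.one_sub_sq_div_two_le_cos (x := z)]

theorem fejerKernel_le_four_div_sq {z : ℝ} (hz : z ≠ 0) : fejerKernel z ≤ 4 / z ^ 2 := by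
  rw [fejerKernel_eq hz]
  gcongr
  linarith [Real.neg_one_le_cos z]

theorem fejerKernel_ge_of_abs_le_one {z : ℝ} (hz : |z| ≤ 1) : 1 / 4 ≤ fejerKernel z := by
  rcases eq_or_ne z 0 with rfl | h0
  · rw [fejerKernel_zero]; norm_num
  · rw [fejerKernel_eq h0, le_div_iff₀ (by positivity)]
    have h1 := Real.cos_le_one_sub_mul_cos_sq (hz.trans (by linarith [Real.pi_gt_three]))
    have h2 : 1 / 8 ≤ 2 / Real.pi ^ 2 := by
      rw [div_le_div_iff₀ (by norm_num) (by positivity)]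
      nlinarith [Real.pi_lt_four, Real.pi_pos]
    nlinarith [sq_nonneg z]

/-- The Fejér-weighted boundary integral of `∑ (Λ n - 1) n ^ (-s)`. -/
noncomputable def fejerBoundaryIntegral (l y δ : ℝ) : ℝ :=
  ∫ t in (0 : ℝ)..1, 2 * (1 - t) * (Complex.exp (-((t * (l * y) : ℝ) : ℂ) * Complex.I)
    * vonMangoldtSubOneSeries (1 + δ - ((t * l : ℝ) : ℂ) * Complex.I)).re

theorem exp_mul_term_re (b : ℕ → ℝ) (l y δ t : ℝ) (hδ : 0 < δ) (n : ℕ) :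
    (Complex.exp (-((t * (l * y) : ℝ) : ℂ) * Complex.I)
      * LSeries.term (fun n => (b n : ℂ)) (1 + δ - ((t * l : ℝ) : ℂ) * Complex.I) n).re
      = b n * (n : ℝ) ^ (-(1 + δ)) * Real.cos (t * (l * (Real.log n - y))) := by
  -- At n = 0 both sides vanish, as 0 to a nonzero real power is 0.
  rcases Nat.eq_zero_or_pos n with rfl | hn
  · have h0 : (0 : ℝ) ^ (-δ + -1) = 0 := Real.zero_rpow (by linarith)
    simp [h0]
  · have hn0 : (0 : ℝ) < n := by exact_mod_cast hn
    have hnC : (n : ℂ) ≠ 0 := by exact_mod_cast hn.ne'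
    rw [LSeries.term_of_ne_zero hn.ne', Complex.cpow_def_of_ne_zero hnC, ← Complex.natCast_log,
      div_eq_mul_inv, ← Complex.exp_neg, mul_left_comm, ← Complex.exp_add, Complex.re_ofReal_mul,
      show -((t * (l * y) : ℝ) : ℂ) * Complex.I
          + -((Real.log n : ℂ) * (1 + δ - ((t * l : ℝ) : ℂ) * Complex.I))
        = ((Real.log n * (-(1 + δ)) : ℝ) : ℂ)
          + ((t * (l * (Real.log n - y)) : ℝ) : ℂ) * Complex.I by push_cast; ring,
      Complex.exp_add, ← Complex.ofReal_exp, Complex.re_ofReal_mul, Complex.exp_ofReal_mul_I_re,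
      Real.rpow_def_of_pos hn0]
    ring

/-- Integrating the Dirichlet series against the triangle on the line Re s = 1 + δ localises log n
near y at scale 1/l; absolute convergence justifies the exchange. -/
theorem hasSum_fejerKernel (l y : ℝ) {δ : ℝ} (hδ : 0 < δ) :
    HasSum (fun n : ℕ => vonMangoldtSubOne n * (n : ℝ) ^ (-(1 + δ))
      * fejerKernel (l * (Real.log n - y))) (fejerBoundaryIntegral l y δ) := by
  have hs0 : Summable fun n : ℕ => 2 * (|vonMangoldtSubOne n| * (n : ℝ) ^ (-(1 + δ))) := by
    have := (hasSum_vonMangoldtSubOneSeries (s := ((1 + δ : ℝ) : ℂ))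
      (by simpa using hδ)).summable.norm
    refine (this.congr fun n => ?_).mul_left 2
    rw [LSeries.norm_term_eq]
    split_ifs with h
    · have h0 : (0 : ℝ) ^ (-δ + -1) = 0 := Real.zero_rpow (by linarith)
      simp [h, h0]
    · rw [Complex.norm_real, Real.norm_eq_abs, Complex.ofReal_re, Real.rpow_neg n.cast_nonneg,
        div_eq_mul_inv]
  have hpt : ∀ t : ℝ, HasSum (fun n : ℕ => 2 * (1 - t) * (vonMangoldtSubOne n
      * (n : ℝ) ^ (-(1 + δ)) * Real.cos (t * (l * (Real.log n - y)))))
      (2 * (1 - t) * (Complex.exp (-((t * (l * y) : ℝ) : ℂ) * Complex.I)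
        * vonMangoldtSubOneSeries (1 + δ - ((t * l : ℝ) : ℂ) * Complex.I)).re) := by
    intro t
    have h := (hasSum_vonMangoldtSubOneSeries (s := 1 + δ - ((t * l : ℝ) : ℂ) * Complex.I)
      (by simpa using hδ)).mul_left (Complex.exp (-((t * (l * y) : ℝ) : ℂ) * Complex.I))
    have h2 := (Complex.hasSum_re h).mul_left (2 * (1 - t))
    simpa only [exp_mul_term_re vonMangoldtSubOne l y δ t hδ] using h2
  have := intervalIntegral.hasSum_integral_of_dominated_convergence (a := (0 : ℝ)) (b := 1)
    (μ := volume) (fun n (_ : ℝ) => 2 * (|vonMangoldtSubOne n| * (n : ℝ) ^ (-(1 + δ))))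
    (F := fun n t => 2 * (1 - t) * (vonMangoldtSubOne n
      * (n : ℝ) ^ (-(1 + δ)) * Real.cos (t * (l * (Real.log n - y)))))
    (fun n => (by fun_prop : Continuous _).aestronglyMeasurable)
    (fun n => Eventually.of_forall fun t ht => by
      rw [Set.uIoc_of_le zero_le_one] at ht
      have h1 : |1 - t| ≤ 1 := abs_le.2 ⟨by linarith [ht.2], by linarith [ht.1]⟩
      have h2 : (0 : ℝ) ≤ (n : ℝ) ^ (-(1 + δ)) := by positivity
      rw [Real.norm_eq_abs, abs_mul, abs_mul, abs_mul, abs_mul, abs_two, abs_of_nonneg h2]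
      calc 2 * |1 - t| * (|vonMangoldtSubOne n| * (n : ℝ) ^ (-(1 + δ))
            * |Real.cos (t * (l * (Real.log n - y)))|)
          ≤ 2 * 1 * (|vonMangoldtSubOne n| * (n : ℝ) ^ (-(1 + δ)) * 1) := by
            gcongr
            exact Real.abs_cos_le_one _
        _ = _ := by ring)
    (Eventually.of_forall fun t _ => hs0)
    (by simp)
    (Eventually.of_forall fun t _ => hpt t)
  refine this.congr_fun fun n => ?_
  rw [fejerKernel, ← intervalIntegral.integral_const_mul]
  refine intervalIntegral.integral_congr fun t _ => ?_
  ring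

theorem tendsto_fejerBoundaryIntegral_zero (l y : ℝ) :
    Tendsto (fun δ => fejerBoundaryIntegral l y δ) (𝓝[>] 0)
      (𝓝 (fejerBoundaryIntegral l y 0)) := by
  -- Replacing δ by max δ 0 keeps the argument in Re s ≥ 1, so continuity holds for all real δ.
  have hcont : Continuous (Function.uncurry fun (δ t : ℝ) => 2 * (1 - t)
      * (Complex.exp (-((t * (l * y) : ℝ) : ℂ) * Complex.I)
        * vonMangoldtSubOneSeries (1 + (max δ 0 : ℝ) - ((t * l : ℝ) : ℂ) * Complex.I)).re) := by
    have : Continuous fun q : ℝ × ℝ =>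
        vonMangoldtSubOneSeries (1 + (max q.1 0 : ℝ) - ((q.2 * l : ℝ) : ℂ) * Complex.I) :=
      continuousOn_vonMangoldtSubOneSeries.comp_continuous (by fun_prop) fun q => by
        simp
    exact (by fun_prop : Continuous fun q : ℝ × ℝ => 2 * (1 - q.2)).mul
      (Complex.continuous_re.comp ((by fun_prop : Continuous fun q : ℝ × ℝ =>
        Complex.exp (-((q.2 * (l * y) : ℝ) : ℂ) * Complex.I)).mul this))
  have h := (intervalIntegral.continuous_parametric_intervalIntegral_of_continuous' (μ := volume)
    hcont 0 1).tendsto 0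
  have h' := h.mono_left (nhdsWithin_le_nhds (s := Set.Ioi 0))
  rw [max_self] at h'
  refine Tendsto.congr' ?_ h'
  filter_upwards [self_mem_nhdsWithin] with δ hδ
  rw [max_eq_left (le_of_lt hδ)]
  rfl

/-- Riemann–Lebesgue: at δ = 0 the integral is a Fourier transform of a compactly supported
integrable function at a frequency proportional to y. -/
theorem tendsto_fejerBoundaryIntegral_atTop {l : ℝ} (hl : 0 < l) :
    Tendsto (fun y => fejerBoundaryIntegral l y 0) atTop (𝓝 0) := by
  have hH : Continuous fun t : ℝ =>
      vonMangoldtSubOneSeries (1 + (0 : ℝ) - ((t * l : ℝ) : ℂ) * Complex.I) :=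
    continuousOn_vonMangoldtSubOneSeries.comp_continuous (by fun_prop) fun q => by simp
  set g : ℝ → ℂ := (Set.Ioc (0 : ℝ) 1).indicator fun t => ((2 * (1 - t) : ℝ) : ℂ)
    * vonMangoldtSubOneSeries (1 + (0 : ℝ) - ((t * l : ℝ) : ℂ) * Complex.I)
  have hRL := Real.tendsto_integral_exp_smul_cocompact g
  have hy : Tendsto (fun y : ℝ => y * (l / (2 * Real.pi))) atTop (cocompact ℝ) :=
    (tendsto_id.atTop_mul_const (by positivity)).mono_right atTop_le_cocompact
  have h := (Complex.continuous_re.tendsto _).comp (hRL.comp hy)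
  rw [Complex.zero_re] at h
  refine h.congr fun y => ?_
  simp only [Function.comp]
  have e : ∀ t : ℝ, Real.fourierChar (-(t * (y * (l / (2 * Real.pi))))) • g t
      = (Set.Ioc (0 : ℝ) 1).indicator (fun t : ℝ => ((2 * (1 - t) : ℝ) : ℂ)
        * (Complex.exp (-((t * (l * y) : ℝ) : ℂ) * Complex.I)
        * vonMangoldtSubOneSeries (1 + (0 : ℝ) - ((t * l : ℝ) : ℂ) * Complex.I))) t := by
    intro t
    by_cases ht : t ∈ Set.Ioc (0 : ℝ) 1
    · simp only [g, Set.indicator_of_mem ht]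
      rw [Circle.smul_def, Real.fourierChar_apply, smul_eq_mul,
        show 2 * Real.pi * -(t * (y * (l / (2 * Real.pi)))) = -(t * (l * y)) by
          field_simp]
      push_cast
      ring
    · simp only [g, Set.indicator_of_notMem ht, smul_zero]
  simp only [e]
  rw [integral_indicator measurableSet_Ioc, fejerBoundaryIntegral,
    intervalIntegral.integral_of_le zero_le_one]
  have hint : Integrable (fun t : ℝ => ((2 * (1 - t) : ℝ) : ℂ)
        * (Complex.exp (-((t * (l * y) : ℝ) : ℂ) * Complex.I)
        * vonMangoldtSubOneSeries (1 + (0 : ℝ) - ((t * l : ℝ) : ℂ) * Complex.I)))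
      (volume.restrict (Set.Ioc 0 1)) :=
    ((((by fun_prop : Continuous fun t : ℝ => ((2 * (1 - t) : ℝ) : ℂ)).mul
      ((by fun_prop : Continuous fun t : ℝ =>
        Complex.exp (-((t * (l * y) : ℝ) : ℂ) * Complex.I)).mul hH)).integrableOn_Icc).mono_set
          Set.Ioc_subset_Icc_self)
  have := integral_re hint
  refine (this.symm.trans ?_)
  refine integral_congr_ae (Eventually.of_forall fun t => ?_)
  simp only [RCLike.re_eq_complex_re, Complex.re_ofReal_mul]

/-! ### Chebyshev bounds and a lower bound on short logarithmic windows. -/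

open ArithmeticFunction in
theorem sum_vonMangoldt_div_le_of_floor_eq (y : ℝ) (m : ℤ) {s : Finset ℕ}
    (hs : ∀ n ∈ s, ⌊Real.log n - y⌋ = m) :
    ∑ n ∈ s, vonMangoldt n / (n : ℝ) ≤ Real.exp 1 * (Real.log 4 + 4) := by
  set E := Real.exp (y + m)
  have hE : 0 < E := Real.exp_pos _
  have hE1 : Real.exp (y + m + 1) = E * Real.exp 1 := Real.exp_add _ _
  have hb : ∀ n ∈ s, n ≠ 0 → E ≤ n ∧ (n : ℝ) ≤ E * Real.exp 1 := by
    intro n hn hn0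
    have hn0' : (0 : ℝ) < n := by exact_mod_cast Nat.pos_of_ne_zero hn0
    obtain ⟨h1, h2⟩ := Int.floor_eq_iff.1 (hs n hn)
    rw [← hE1, ← Real.le_log_iff_exp_le hn0', ← Real.log_le_iff_le_exp hn0']
    constructor <;> linarith
  have h1 : ∑ n ∈ s, vonMangoldt n / (n : ℝ)
      ≤ (∑ n ∈ s.filter (· ≠ 0), vonMangoldt n) / E := by
    rw [Finset.sum_div, Finset.sum_filter]
    refine Finset.sum_le_sum fun n hn => ?_
    split_ifs with h
    · exact div_le_div_of_nonneg_left vonMangoldt_nonneg hE (hb n hn h).1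
    · simp [not_not.1 h]
  have h2 : ∑ n ∈ s.filter (· ≠ 0), vonMangoldt n ≤ Chebyshev.psi (E * Real.exp 1) := by
    rw [Chebyshev.psi]
    refine Finset.sum_le_sum_of_subset_of_nonneg (fun n hn => ?_) fun _ _ _ => vonMangoldt_nonneg
    obtain ⟨hn1, hn2⟩ := Finset.mem_filter.1 hn
    exact Finset.mem_Ioc.2 ⟨Nat.pos_of_ne_zero hn2, Nat.le_floor (hb n hn1 hn2).2⟩
  calc _ ≤ Chebyshev.psi (E * Real.exp 1) / E := h1.trans (by gcongr)
    _ ≤ (Real.log 4 + 4) * (E * Real.exp 1) / E := by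
        gcongr
        exact Chebyshev.psi_le_const_mul_self (by positivity)
    _ = _ := by field_simp

theorem summable_inv_one_add_int_sq : Summable fun m : ℤ => 3 / (1 + (m : ℝ) ^ 2) := by
  refine Summable.of_norm_bounded_eventually
    (((Real.summable_one_div_int_pow (p := 2)).2 one_lt_two).mul_left 3) ?_
  filter_upwards [(Set.finite_singleton (0 : ℤ)).compl_mem_cofinite] with m hm
  have hm0 : (m : ℝ) ≠ 0 := by exact_mod_cast hm
  rw [Real.norm_of_nonneg (by positivity), mul_one_div]
  gcongr
  linarith

theorem one_div_one_add_sq_le_floor (z : ℝ) :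
    1 / (1 + z ^ 2) ≤ 3 / (1 + (⌊z⌋ : ℝ) ^ 2) := by
  rw [div_le_div_iff₀ (by positivity) (by positivity)]
  have h1 := Int.floor_le z
  have h2 := (Int.lt_floor_add_one z).le
  nlinarith [sq_nonneg (z - ⌊z⌋), sq_nonneg (2 * z + (z - ⌊z⌋)), sq_nonneg (2 * z - (⌊z⌋ : ℝ))]

-- By Chebyshev each unit interval of log n carries bounded Λ(n)/n mass, and the weight is summable
-- over unit intervals. Uniformity in y is what controls the Fejér tails.
open ArithmeticFunction in
theorem exists_sum_vonMangoldt_tail_le :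
    ∃ C : ℝ, 0 < C ∧ ∀ (y : ℝ) (s : Finset ℕ),
      ∑ n ∈ s, vonMangoldt n / (n : ℝ) * (1 / (1 + (Real.log n - y) ^ 2)) ≤ C := by
  set C₀ := Real.exp 1 * (Real.log 4 + 4)
  have hC₀ : 0 < C₀ := by
    have := Real.log_pos (show (1 : ℝ) < 4 by norm_num)
    positivity
  refine ⟨C₀ * ∑' m : ℤ, 3 / (1 + (m : ℝ) ^ 2), mul_pos hC₀
    (summable_inv_one_add_int_sq.tsum_pos (fun m => by positivity) 0 (by positivity)),
    fun y s => ?_⟩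
  set t := s.image fun n : ℕ => ⌊Real.log n - y⌋
  rw [← Finset.sum_fiberwise_of_maps_to (t := t) (g := fun n : ℕ => ⌊Real.log n - y⌋)
    fun n hn => Finset.mem_image_of_mem _ hn]
  calc _ ≤ ∑ m ∈ t, C₀ * (3 / (1 + (m : ℝ) ^ 2)) := by
        refine Finset.sum_le_sum fun m _ => ?_
        have hm : ∀ n ∈ s.filter (fun n : ℕ => ⌊Real.log n - y⌋ = m), ⌊Real.log n - y⌋ = m :=
          fun n hn => (Finset.mem_filter.1 hn).2
        calc _ ≤ ∑ n ∈ s.filter (fun n : ℕ => ⌊Real.log n - y⌋ = m),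
              vonMangoldt n / (n : ℝ) * (3 / (1 + (m : ℝ) ^ 2)) := by
              refine Finset.sum_le_sum fun n hn => mul_le_mul_of_nonneg_left ?_
                (div_nonneg vonMangoldt_nonneg n.cast_nonneg)
              rw [← hm n hn]
              exact one_div_one_add_sq_le_floor _
          _ ≤ _ := by
              rw [← Finset.sum_mul]
              exact mul_le_mul_of_nonneg_right (sum_vonMangoldt_div_le_of_floor_eq y m hm)
                (by positivity)
    _ ≤ _ := by
        rw [← Finset.mul_sum]
        gcongr
        exact summable_inv_one_add_int_sq.sum_le_tsum _ fun m _ => by positivity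

theorem summable_rpow_mul_fejerKernel (l y : ℝ) {δ : ℝ} (hδ : 0 < δ) :
    Summable fun n : ℕ => (n : ℝ) ^ (-(1 + δ)) * fejerKernel (l * (Real.log n - y)) := by
  refine Summable.of_nonneg_of_le (fun n => mul_nonneg (by positivity) (fejerKernel_nonneg _))
    (fun n => mul_le_of_le_one_right (by positivity) (fejerKernel_le_one _))
    (Real.summable_nat_rpow.2 (by linarith))

/-- The integers in (e^{y − 1/l}, e^y] alone suffice: there are at least e^y / (4l) of them, and the
kernel is at least 1/4 on them. The condition on y absorbs the rounding error 1. -/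
theorem tsum_rpow_mul_fejerKernel_ge {l y δ : ℝ} (hl : 1 ≤ l) (hδ : 0 < δ)
    (hy : Real.exp (-y) ≤ 1 / (4 * l)) :
    Real.exp (-(δ * y)) / (16 * l)
      ≤ ∑' n : ℕ, (n : ℝ) ^ (-(1 + δ)) * fejerKernel (l * (Real.log n - y)) := by
  have hl0 : 0 < l := by linarith
  set A := Real.exp (y - 1 / l)
  set B := Real.exp y
  have hAB : ⌊A⌋₊ ≤ ⌊B⌋₊ := Nat.floor_mono (Real.exp_le_exp.2 (by
    have : 0 < 1 / l := by positivity
    linarith))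
  have hterm : ∀ n ∈ Finset.Ioc ⌊A⌋₊ ⌊B⌋₊, Real.exp (-(y * (1 + δ))) * (1 / 4)
      ≤ (n : ℝ) ^ (-(1 + δ)) * fejerKernel (l * (Real.log n - y)) := by
    intro n hn
    obtain ⟨h1, h2⟩ := Finset.mem_Ioc.1 hn
    have hn0 : (0 : ℝ) < n := by exact_mod_cast (by omega : 0 < n)
    have h3 : A ≤ n := ((Nat.floor_lt (Real.exp_pos _).le).1 h1).le
    have h4 : (n : ℝ) ≤ B := (Nat.le_floor_iff (Real.exp_pos _).le).1 h2
    rw [← Real.le_log_iff_exp_le hn0] at h3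
    rw [← Real.log_le_iff_le_exp hn0] at h4
    refine mul_le_mul ?_ (fejerKernel_ge_of_abs_le_one ?_) (by norm_num) (by positivity)
    · rw [Real.rpow_def_of_pos hn0, Real.exp_le_exp]
      nlinarith
    · rw [abs_mul, abs_of_pos hl0, abs_of_nonpos (by linarith)]
      calc l * -(Real.log n - y) ≤ l * (1 / l) := by gcongr; linarith
        _ = 1 := by field_simp
  have hcard : B - 1 - A ≤ (Finset.Ioc ⌊A⌋₊ ⌊B⌋₊).card := by
    rw [Nat.card_Ioc, Nat.cast_sub hAB]
    linarith [Nat.lt_floor_add_one B, Nat.floor_le (Real.exp_pos (y - 1 / l)).le]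
  have hexp : Real.exp (-(1 / l)) ≤ 1 - 1 / (2 * l) := by
    set t := 1 / l with ht
    have ht0 : 0 < t := by positivity
    have ht1 : t ≤ 1 := by rw [ht, div_le_one hl0]; exact hl
    have e : 1 / (2 * l) = t / 2 := by rw [ht]; field_simp
    rw [e, Real.exp_neg, inv_le_comm₀ (Real.exp_pos _) (by linarith)]
    refine le_trans ?_ (Real.add_one_le_exp t)
    rw [inv_le_iff_one_le_mul₀ (by linarith)]
    nlinarith
  have hmain : B * (1 / (4 * l)) ≤ B - 1 - A := by
    have hA : A = B * Real.exp (-(1 / l)) := by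
      simp only [A, B, ← Real.exp_add, sub_eq_add_neg]
    have h1 : B * Real.exp (-y) = 1 := by rw [← Real.exp_add]; simp
    have hB : 0 < B := Real.exp_pos _
    have h5 := mul_le_mul_of_nonneg_left hexp hB.le
    have h6 := mul_le_mul_of_nonneg_left hy hB.le
    have e : B * (1 - 1 / (2 * l)) = B - B * (1 / (4 * l)) - B * (1 / (4 * l)) := by
      field_simp; ring
    rw [hA]; linarith
  calc Real.exp (-(δ * y)) / (16 * l)
      = B * (1 / (4 * l)) * (Real.exp (-(y * (1 + δ))) * (1 / 4)) := by
        rw [show -(δ * y) = y + -(y * (1 + δ)) by ring, Real.exp_add]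
        field_simp; ring
    _ ≤ (Finset.Ioc ⌊A⌋₊ ⌊B⌋₊).card * (Real.exp (-(y * (1 + δ))) * (1 / 4)) := by
        gcongr; exact hmain.trans hcard
    _ ≤ ∑ n ∈ Finset.Ioc ⌊A⌋₊ ⌊B⌋₊,
          (n : ℝ) ^ (-(1 + δ)) * fejerKernel (l * (Real.log n - y)) := by
        rw [← nsmul_eq_mul, ← Finset.sum_const]
        exact Finset.sum_le_sum hterm
    _ ≤ _ := (summable_rpow_mul_fejerKernel l y hδ).sum_le_tsum _ fun n _ =>
        mul_nonneg (by positivity) (fejerKernel_nonneg _)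

/-- The positive integers `n` with `|log n - y| ≤ ε`. -/
noncomputable def logWindow (y ε : ℝ) : Finset ℕ :=
  (Finset.Icc 1 ⌊Real.exp (y + ε)⌋₊).filter fun n => |Real.log n - y| ≤ ε

theorem mem_logWindow {y ε : ℝ} {n : ℕ} :
    n ∈ logWindow y ε ↔ 0 < n ∧ |Real.log n - y| ≤ ε := by
  simp only [logWindow, Finset.mem_filter, Finset.mem_Icc]
  constructor
  · rintro ⟨⟨h1, _⟩, h2⟩; exact ⟨h1, h2⟩
  · rintro ⟨h1, h2⟩
    have hn0 : (0 : ℝ) < n := by exact_mod_cast h1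
    refine ⟨⟨h1, Nat.le_floor ?_⟩, h2⟩
    rw [← Real.log_le_iff_le_exp hn0]
    linarith [(abs_le.1 h2).2]

-- Adding the smoothed sum of 1 to that of Λ − 1 gives the smoothed sum of Λ. Inside the window the
-- kernel is at most 1; outside, 4/(lz)² ≤ 8/(l²ε²) · 1/(1 + z²) because |z| > ε and ε ≤ 1.
open ArithmeticFunction in
theorem fejer_inequality {C : ℝ} (hC : ∀ (y : ℝ) (s : Finset ℕ),
      ∑ n ∈ s, vonMangoldt n / (n : ℝ) * (1 / (1 + (Real.log n - y) ^ 2)) ≤ C)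
    {l y δ ε : ℝ} (hl : 1 ≤ l) (hδ : 0 < δ) (hε : 0 < ε) (hε1 : ε ≤ 1)
    (hy : Real.exp (-y) ≤ 1 / (4 * l)) :
    Real.exp (-(δ * y)) / (16 * l) + fejerBoundaryIntegral l y δ
      ≤ ∑ n ∈ logWindow y ε, vonMangoldt n / (n : ℝ) + 8 / (l ^ 2 * ε ^ 2) * C := by
  have hl0 : 0 < l := by linarith
  have h1 := (hasSum_fejerKernel l y hδ).add (summable_rpow_mul_fejerKernel l y hδ).hasSum
  have h2 := tsum_rpow_mul_fejerKernel_ge hl hδ hy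
  suffices fejerBoundaryIntegral l y δ
      + ∑' n : ℕ, (n : ℝ) ^ (-(1 + δ)) * fejerKernel (l * (Real.log n - y))
      ≤ ∑ n ∈ logWindow y ε, vonMangoldt n / (n : ℝ) + 8 / (l ^ 2 * ε ^ 2) * C by linarith
  refine hasSum_le_of_sum_le h1 fun s => ?_
  have hterm : ∀ n ∈ s, vonMangoldtSubOne n * (n : ℝ) ^ (-(1 + δ))
        * fejerKernel (l * (Real.log n - y))
        + (n : ℝ) ^ (-(1 + δ)) * fejerKernel (l * (Real.log n - y))
      ≤ (if n ∈ logWindow y ε then vonMangoldt n / (n : ℝ) else 0) + 8 / (l ^ 2 * ε ^ 2)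
        * (vonMangoldt n / (n : ℝ) * (1 / (1 + (Real.log n - y) ^ 2))) := by
    intro n _
    have e : vonMangoldtSubOne n * (n : ℝ) ^ (-(1 + δ)) * fejerKernel (l * (Real.log n - y))
        + (n : ℝ) ^ (-(1 + δ)) * fejerKernel (l * (Real.log n - y))
        = vonMangoldt n * (n : ℝ) ^ (-(1 + δ)) * fejerKernel (l * (Real.log n - y)) := by
      rw [vonMangoldtSubOne]; ring
    rw [e]
    rcases Nat.eq_zero_or_pos n with rfl | hn
    · simp
    have hn1 : (1 : ℝ) ≤ n := by exact_mod_cast hn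
    have hΛ : 0 ≤ vonMangoldt n / (n : ℝ) := div_nonneg vonMangoldt_nonneg n.cast_nonneg
    have h3 : vonMangoldt n * (n : ℝ) ^ (-(1 + δ)) ≤ vonMangoldt n / (n : ℝ) := by
      rw [div_eq_mul_inv, ← Real.rpow_neg_one]
      exact mul_le_mul_of_nonneg_left (Real.rpow_le_rpow_of_exponent_le hn1 (by linarith))
        vonMangoldt_nonneg
    have h4 := mul_le_mul_of_nonneg_right h3 (fejerKernel_nonneg (l * (Real.log n - y)))
    refine h4.trans ?_
    split_ifs with hmem
    · exact (mul_le_of_le_one_right hΛ (fejerKernel_le_one _)).trans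
        (le_add_of_nonneg_right (by positivity))
    · have hz : ε < |Real.log n - y| := by
        by_contra! hcon
        exact hmem (mem_logWindow.2 ⟨hn, hcon⟩)
      set z := Real.log n - y
      have hz0 : z ≠ 0 := abs_pos.1 (hε.trans hz)
      have hz2 : ε ^ 2 ≤ z ^ 2 := by rw [← sq_abs z]; gcongr
      have hz3 : ε ^ 2 * z ^ 2 ≤ z ^ 2 :=
        mul_le_of_le_one_left (sq_nonneg _) (pow_le_one₀ hε.le hε1)
      rw [zero_add, mul_left_comm]
      refine mul_le_mul_of_nonneg_left ((fejerKernel_le_four_div_sq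
        (mul_ne_zero hl0.ne' hz0)).trans ?_) hΛ
      rw [div_mul_div_comm, mul_one, div_le_div_iff₀ (by positivity) (by positivity)]
      nlinarith [mul_le_mul_of_nonneg_left (add_le_add hz2 hz3) (sq_nonneg l)]
  refine (Finset.sum_le_sum hterm).trans ?_
  rw [Finset.sum_add_distrib, ← Finset.mul_sum]
  refine add_le_add ?_ (mul_le_mul_of_nonneg_left (hC y s) (by positivity))
  rw [← Finset.sum_filter]
  exact Finset.sum_le_sum_of_subset_of_nonneg (fun n hn => (Finset.mem_filter.1 hn).2)
    fun n _ _ => div_nonneg vonMangoldt_nonneg n.cast_nonneg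

open ArithmeticFunction in
/-- Logarithmic windows of fixed length carry a positive amount of `∑ Λ n / n`. -/
theorem exists_logWindow_lower_bound {ε : ℝ} (hε : 0 < ε) (hε1 : ε ≤ 1) :
    ∃ c : ℝ, 0 < c ∧ ∀ᶠ y : ℝ in atTop, c ≤ ∑ n ∈ logWindow y ε, vonMangoldt n / (n : ℝ) := by
  obtain ⟨C, hC0, hC⟩ := exists_sum_vonMangoldt_tail_le
  -- The main term decays like 1/l and the tail like 1/l², so a large l makes the tail at most a
  -- quarter of 1/(16l). First δ → 0 at fixed y, then y is large.
  set l : ℝ := max 1 (512 * C / ε ^ 2)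
  have hl : 1 ≤ l := le_max_left _ _
  have hl0 : 0 < l := by linarith
  refine ⟨1 / (64 * l), by positivity, ?_⟩
  have htail : 8 / (l ^ 2 * ε ^ 2) * C ≤ 1 / (64 * l) := by
    have h1 : 512 * C / ε ^ 2 ≤ l := le_max_right _ _
    rw [div_le_iff₀ (by positivity)] at h1
    rw [div_mul_eq_mul_div, div_le_div_iff₀ (by positivity) (by positivity)]
    nlinarith [mul_le_mul_of_nonneg_left h1 hl0.le]
  have hexp : ∀ᶠ y : ℝ in atTop, Real.exp (-y) ≤ 1 / (4 * l) :=
    (Real.tendsto_exp_neg_atTop_nhds_zero.eventually_lt_const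
      (show (0 : ℝ) < 1 / (4 * l) by positivity)).mono fun _ h => h.le
  have hbd : ∀ᶠ y : ℝ in atTop, -(1 / (64 * l)) < fejerBoundaryIntegral l y 0 :=
    (tendsto_fejerBoundaryIntegral_atTop hl0).eventually_const_lt
      (by have : 0 < 1 / (64 * l) := by positivity
          linarith)
  filter_upwards [hexp, hbd] with y hy1 hy2
  have hlim : Tendsto (fun δ => Real.exp (-(δ * y)) / (16 * l) + fejerBoundaryIntegral l y δ)
      (𝓝[>] 0) (𝓝 (Real.exp (-(0 * y)) / (16 * l) + fejerBoundaryIntegral l y 0)) := by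
    refine Tendsto.add ?_ (tendsto_fejerBoundaryIntegral_zero l y)
    exact ((by fun_prop : Continuous fun δ : ℝ => Real.exp (-(δ * y)) / (16 * l)).tendsto 0).mono_left
      nhdsWithin_le_nhds
  have hle := le_of_tendsto hlim (b := ∑ n ∈ logWindow y ε, vonMangoldt n / (n : ℝ)
    + 8 / (l ^ 2 * ε ^ 2) * C) (by
      filter_upwards [self_mem_nhdsWithin] with δ hδ
      exact fejer_inequality hC hl hδ hε hε1 hy1)
  rw [zero_mul, neg_zero, Real.exp_zero] at hle
  have e : 1 / (16 * l) = 4 * (1 / (64 * l)) := by field_simp; norm_num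
  have hu : 0 < 1 / (64 * l) := by positivity
  linarith

/-! ### From Λ to primes. -/

open ArithmeticFunction in
theorem summable_vonMangoldt_nonprime :
    Summable fun n : ℕ => (if n.Prime then 0 else vonMangoldt n) / (n : ℝ) := by
  refine (vonMangoldt.summable_residueClass_non_primes_div (1 : ZMod 1)).congr fun n => ?_
  have h : vonMangoldt.residueClass (1 : ZMod 1) n = vonMangoldt n :=
    Set.indicator_of_mem (s := {m : ℕ | (m : ZMod 1) = 1}) (Subsingleton.elim _ _) _
  rw [h]

open ArithmeticFunction in
theorem windowLowerBound : WindowLowerBound := by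
  intro ε hε
  -- A half-width below ε/2 puts the window centred at ε(j + 1/2) strictly inside window j.
  set ε' := min (ε / 3) 1
  have hε' : 0 < ε' := lt_min (by positivity) one_pos
  obtain ⟨c, hc, hcy⟩ := exists_logWindow_lower_bound hε' (min_le_right _ _)
  obtain ⟨s₀, hs₀⟩ := summable_iff_vanishing_norm.1 summable_vonMangoldt_nonprime (c / 2)
    (by positivity)
  refine ⟨c / (4 * ε), by positivity, ?_⟩
  have hy : Tendsto (fun j : ℕ => ε * ((j : ℝ) + 1 / 2)) atTop atTop :=
    (tendsto_natCast_atTop_atTop.atTop_add tendsto_const_nhds).const_mul_atTop hε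
  have hbig : ∀ᶠ j : ℕ in atTop, ∀ n ∈ s₀, Real.log n < ε * j := by
    rw [Filter.eventually_all_finset]
    intro n _
    exact (tendsto_natCast_atTop_atTop.const_mul_atTop hε).eventually_gt_atTop _
  filter_upwards [hy.eventually hcy, hbig, eventually_ge_atTop 1] with j hj hjs hj1
  set V := logWindow (ε * ((j : ℝ) + 1 / 2)) ε'
  have hV : ∀ n ∈ V, ε * j < Real.log n ∧ Real.log n < ε * (j + 1) := by
    intro n hn
    have h1 := abs_le.1 ((mem_logWindow.1 hn).2.trans (min_le_left _ _))
    constructor <;> nlinarith [h1.1, h1.2]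
  have hj0 : (1 : ℝ) ≤ j := by exact_mod_cast hj1
  -- Proper prime powers have a convergent Λ(n)/n sum, and for large j the window avoids the finite
  -- set carrying all but c/2 of it.
  have hnp : ∑ n ∈ V, (if n.Prime then 0 else vonMangoldt n) / (n : ℝ) ≤ c / 2 := by
    refine (le_abs_self _).trans (hs₀ V (Finset.disjoint_left.2 fun n hn hn0 => ?_)).le
    exact lt_asymm (hV n hn).1 (hjs n hn0)
  have hsplit : ∑ n ∈ V, vonMangoldt n / (n : ℝ)
      = ∑ n ∈ V.filter Nat.Prime, vonMangoldt n / (n : ℝ)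
        + ∑ n ∈ V, (if n.Prime then 0 else vonMangoldt n) / (n : ℝ) := by
    rw [Finset.sum_filter, ← Finset.sum_add_distrib]
    exact Finset.sum_congr rfl fun n _ => by split_ifs <;> simp
  -- Here Λ(p) = log p ≤ ε(j + 1) ≤ 2εj, whence the constant c / (4ε).
  have hprime : ∑ n ∈ V.filter Nat.Prime, vonMangoldt n / (n : ℝ)
      ≤ 2 * ε * j * ∑ p ∈ primeWindow ε j, 1 / (p : ℝ) := by
    calc _ ≤ ∑ p ∈ V.filter Nat.Prime, 2 * ε * j * (1 / (p : ℝ)) := by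
          refine Finset.sum_le_sum fun p hp => ?_
          obtain ⟨hp1, hp2⟩ := Finset.mem_filter.1 hp
          rw [vonMangoldt_apply_prime hp2, mul_one_div]
          gcongr
          nlinarith [(hV p hp1).2]
      _ ≤ _ := by
          rw [← Finset.mul_sum]
          refine mul_le_mul_of_nonneg_left (Finset.sum_le_sum_of_subset_of_nonneg (fun p hp => ?_)
            fun _ _ _ => by positivity) (by positivity)
          obtain ⟨hp1, hp2⟩ := Finset.mem_filter.1 hp
          obtain ⟨h1, h2⟩ := hV p hp1
          refine (mem_primeWindow hε).2 ⟨hp2, ?_⟩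
          rw [Nat.floor_eq_iff (div_nonneg (Real.log_natCast_nonneg p) hε.le),
            le_div_iff₀ hε, div_lt_iff₀ hε]
          constructor <;> linarith
  rw [div_div, div_le_iff₀ (by positivity)]
  nlinarith

theorem mainTheorem11 :
    (∀ (X : Type*) [MetricSpace X] [CompactSpace X] [MeasurableSpace X] [BorelSpace X]
      (μ : Measure X) (T : X → X), Continuous T →
      ∀ a : ℕ → ℕ, CompletelyAdditive a →
        (a '' {p : ℕ | p.Prime}).Finite →
        ReciprocalSumDiverges {p : ℕ | p.Prime ∧ a p ≠ 0} →
        (∀ p : ℕ, p.Prime → a p ≠ 0 → UniquelyErgodic μ (T^[a p])) →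
        ∀ (f : C(X, ℂ)) (x : X),
          Tendsto (fun N : ℕ => (1 / (N : ℂ)) * ∑ n ∈ Finset.Icc 1 N, f (T^[a n] x))
            atTop (𝓝 (∫ y, f y ∂μ))) ∧
    (∀ Q : Set ℕ, (∀ p ∈ Q, p.Prime) → ReciprocalSumDiverges Q →
      Tendsto (fun N : ℕ => (1 / (N : ℝ)) * ∑ n ∈ Finset.Icc 1 N, liouvilleIn Q n)
        atTop (𝓝 0)) ∧
    (∀ Q : Set ℕ, (∀ p ∈ Q, p.Prime) → ∀ τ : ℝ, 0 < τ → HasRelativePrimeDensity Q τ →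
      Tendsto (fun N : ℕ => (1 / (N : ℝ)) * ∑ n ∈ Finset.Icc 1 N, liouvilleIn Q n)
        atTop (𝓝 0)) := by
  refine ⟨fun X _ _ _ _ μ T _ a ha hfin hdiv hue f x =>
      tendsto_mean_of_uniquelyErgodic windowLowerBound ha hfin hdiv hue f x,
    fun Q hQ hdiv => tendsto_mean_liouvilleIn windowLowerBound hQ hdiv,
    fun Q hQ τ hτ h => tendsto_mean_liouvilleIn windowLowerBound hQ
      (reciprocalSumDiverges_of_hasRelativePrimeDensity hτ h)⟩
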